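/- For a finite set $A$ of positive integers write $R(A)=\sum_{n\in A}\frac1n$, and for a positive integer $N$ let $\lambda(N)$ be the maximum of $R(A)$ over all sets $A\subseteq\{1,\dots,N\}$ that contain no subset $B$ with $R(B)=1$. For every $\varepsilon>0$ there is an $N_0=N_0(\varepsilon)$ such that for every integer $N\ge N_0$, every set $A\subseteq\{1,\dots,N\}$ with $\sum_{n\in A}\frac1n\ge(\log N)^{4/5+\varepsilon}$ contains a subset $B\subseteq A$ with $\sum_{n\in B}\frac1n=1$. Equivalently, there is a function $o(N)$ with $o(N)\to0$ as $N\to\infty$ such that $\lambda(N)\le(\log N)^{4/5+o(N)}$ for all sufficiently large integers $N$. In particular, $\lambda(N)=o\!\left(\frac{\log N\,\log\log\log N}{\log\log N}\right)$ as $N\to\infty$. -/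

import Mathlib

/-- `R(A)`, the sum of the reciprocals of the elements of `A`. -/
noncomputable def recipSum (A : Finset ℕ) : ℝ := ∑ n ∈ A, 1 / (n : ℝ)

/-- The values `R(A)`, where `A ⊆ {1, …, N}` has no subset whose reciprocals sum to `1`. -/
def recipSumsOfFree (N : ℕ) : Set ℝ :=
  {x | ∃ A : Finset ℕ, A ⊆ Finset.Icc 1 N ∧ (∀ B ⊆ A, recipSum B ≠ 1) ∧ recipSum A = x}

/-- `λ(N)`, the largest value of `R(A)` over those `A ⊆ {1, …, N}` that have no subset whose
reciprocals sum to `1`. -/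
noncomputable def lam (N : ℕ) : ℝ := sSup (recipSumsOfFree N)

/-- The supremum defining `λ(N)` is a maximum. -/
theorem lam_isGreatest (N : ℕ) : IsGreatest (recipSumsOfFree N) (lam N) := by
  have hfin : (recipSumsOfFree N).Finite := by
    refine ((Finset.Icc 1 N).powerset.image recipSum).finite_toSet.subset ?_
    rintro x ⟨A, hA, -, rfl⟩
    exact Finset.mem_coe.2 (Finset.mem_image_of_mem _ (Finset.mem_powerset.2 hA))
  have hne : (recipSumsOfFree N).Nonempty := by
    refine ⟨_, ∅, Finset.empty_subset _, fun B hB => ?_, rfl⟩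
    rw [Finset.subset_empty.1 hB]
    simp [recipSum]
  exact ⟨hne.csSup_mem hfin, fun x hx => le_csSup hfin.bddAbove hx⟩

/-!
A set `A ⊆ {1, …, N}` with `R(A) ≥ (log N) ^ (4 / 5 + ε)` is first replaced by a subset of itself
with better arithmetic, in which a subset with reciprocal sum `1` is then found by a probabilistic
form of the circle method.

**The circle method.** Let `A` lie in `[M, V]` with `R(A) ≥ 2`, and let `S` be the random subset of
`A` that contains each element independently with probability `1 / R(A)`, so that `R(S)` has mean
`1`. If `Q` is a common multiple of the elements of `A`, orthogonality of the characters modulo `Q`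
expresses the probability that `R(S)` is an integer as the average over `h` modulo `Q` of the
characteristic function at `h`. If no subset has reciprocal sum `1`, this probability is tiny, since
`R(S)` can only be an integer when `S = ∅` or `R(S) ≥ 2` (`sum_re_charFun_le`). To contradict this,
the sum over `h` of the characteristic function is bounded below. The frequency `0` contributes
`1`. As the mean is the integer `1`, the other small frequencies contribute a nonnegative real part
(`re_charFun_nonneg`), and those of medium size are negligible since every `h / n` is far from an
integer (`norm_charFun_le_of_middle`).

For a large frequency `h` let `I` be the interval of length `K` around `h`. A prime power `q` is
*rich* if at least half of the multiples of `q` in `A`, weighted by reciprocals, divide some integer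
in `I`. Each prime power that is not rich forces a factor `exp (-b)` (`norm_charFun_le_of_poor`).
If, for each `h`, all rich prime powers divide one and the same integer in `I`, then there are few
`h` with a given set of rich prime powers, and the large frequencies are negligible as well
(`exists_recipSum_eq_one_of_structure`).

**Rich prime powers divide a common integer.** Suppose that the multiples of every prime power `q`
that occurs carry a reciprocal sum of at least `ρ / q`. Write the elements of `A` that are divisible
by a rich `q` and divide an integer in `I` as `q * u * m` with `u` free of primes up to `y` and `m`
composed of such primes. Some `u` carries its share of the mass, and the elements with that `u` all
divide the unique multiple of `q * u` in `I`, say `x`. So the primes up to `y` that divide `x` have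
a large Euler product (`exists_multiple_of_rich`). If two such integers have Euler products whose
product exceeds the full Euler product over the primes up to `y` (of order `log y`, by Mertens:
`eulerProd_primesLE_le`) by enough, then they share so many primes that the product of these
exceeds `K` (`lt_prod_inter`). This product divides the difference of the two integers, which is at
most `K`, and so the two are equal (`exists_common_multiple_of_rich`).

**Preparing the set.** With `L = log N`, discard the `n` that have a prime power divisor close to
`n`, and those that have a large `y`-smooth divisor; the latter are few by Rankin's method
(`recipSum_large_smooth_le`, `exists_subset_smooth_parts_small`). Then restrict to a window
`[exp μ, exp (μ + w)]` with `w = L ^ (4 / 5)`, keeping a reciprocal sum of about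
`L ^ (3 / 5 + ε)`, and pass to a subset in which every prime power carries its share, with
`ρ = L ^ (3 / 5 + ε - o(1))` (`exists_balanced_window`). With `log y = L ^ (4 / 5 - ε)` the integers
free of primes up to `y` have reciprocal sum `O(L / log y)`, so the Euler products above are at
least of order `τ = ρ * log y / L`. The requirement that `τ ^ 2` exceed
`log y` by logarithmic factors reads `ρ ^ 2 * log y > L ^ (2 + o(1))`, and it holds
(`mul_log_lt_sq`); it is what makes the exponent `4 / 5` critical. All conditions of the circle
method are then met (`exists_recipSum_eq_one_of_window`).
-/

namespace UnitFractions

open Finset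

/-! ### Euler products and the upper bound of Mertens -/

/-- The product of `(1 - 1/p)⁻¹` over `p ∈ P`; it is only used for finite sets `P` of primes, and it
then equals the sum of `1 / m` over the integers `m` all of whose prime factors lie in `P`. -/
noncomputable def eulerProd (P : Finset ℕ) : ℝ := ∏ p ∈ P, (1 - 1 / (p : ℝ))⁻¹

/-- A finite sum over integers composed of primes in `P` is part of the expanded Euler product. -/
lemma sum_le_prod_one_sub_inv {f : ℕ →* ℝ} (hf0 : ∀ n, 0 ≤ f n)
    (hf : ∀ {p : ℕ}, p.Prime → f p < 1) {T P : Finset ℕ} (hP : ∀ p ∈ P, p.Prime)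
    (hT : ∀ m ∈ T, m ≠ 0 ∧ ∀ p, p.Prime → p ∣ m → p ∈ P) :
    ∑ m ∈ T, f m ≤ ∏ p ∈ P, (1 - f p)⁻¹ := by
  obtain ⟨-, h2⟩ := EulerProduct.summable_and_hasSum_factoredNumbers_prod_filter_prime_geometric
    (f := f) (fun {p} hp => by rw [Real.norm_of_nonneg (hf0 p)]; exact hf hp) P
  rw [filter_true_of_mem hP] at h2
  have hmem : ∀ m ∈ T, m ∈ Nat.factoredNumbers P := fun m hm =>
    Nat.mem_factoredNumbers'.2 (hT m hm).2
  have := sum_le_hasSum (T.subtype (· ∈ Nat.factoredNumbers P)) (fun i _ => hf0 i) h2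
  rwa [sum_subtype_of_mem (fun m => f m) hmem] at this

lemma prod_one_sub_inv_le_of_sum_le {f : ℕ →* ℝ} (hf0 : ∀ n, 0 ≤ f n)
    (hf : ∀ {p : ℕ}, p.Prime → f p < 1) {P : Finset ℕ} (hP : ∀ p ∈ P, p.Prime) {c : ℝ}
    (hc : ∀ T : Finset ℕ, (∀ m ∈ T, m ≠ 0) → ∑ m ∈ T, f m ≤ c) :
    ∏ p ∈ P, (1 - f p)⁻¹ ≤ c := by
  obtain ⟨-, h2⟩ := EulerProduct.summable_and_hasSum_factoredNumbers_prod_filter_prime_geometric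
    (f := f) (fun {p} hp => by rw [Real.norm_of_nonneg (hf0 p)]; exact hf hp) P
  rw [filter_true_of_mem hP] at h2
  refine hasSum_le_of_sum_le h2 fun s => ?_
  have := hc (s.map (Function.Embedding.subtype _)) (by
    intro m hm
    obtain ⟨a, -, rfl⟩ := mem_map.1 hm
    exact Nat.ne_zero_of_mem_factoredNumbers a.2)
  rwa [sum_map] at this

/-- The completely multiplicative function `n ↦ n ^ (-s)`. -/
noncomputable def rpowNeg (s : ℝ) : ℕ →* ℝ where
  toFun n := (n : ℝ) ^ (-s)
  map_one' := by simp
  map_mul' m n := by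
    push_cast
    exact Real.mul_rpow (Nat.cast_nonneg m) (Nat.cast_nonneg n)

lemma rpowNeg_apply (s : ℝ) (n : ℕ) : rpowNeg s n = (n : ℝ) ^ (-s) := rfl

lemma rpowNeg_nonneg (s : ℝ) (n : ℕ) : 0 ≤ rpowNeg s n := Real.rpow_nonneg (Nat.cast_nonneg n) _

lemma rpowNeg_prime_lt_one {s : ℝ} (hs : 0 < s) {p : ℕ} (hp : p.Prime) : rpowNeg s p < 1 :=
  Real.rpow_lt_one_of_one_lt_of_neg (by exact_mod_cast hp.one_lt) (by linarith)

lemma rpowNeg_one (n : ℕ) : rpowNeg 1 n = 1 / (n : ℝ) := by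
  rw [rpowNeg_apply, Real.rpow_neg_one, one_div]

lemma sum_inv_le_eulerProd {T P : Finset ℕ} (hP : ∀ p ∈ P, p.Prime)
    (hT : ∀ m ∈ T, m ≠ 0 ∧ ∀ p, p.Prime → p ∣ m → p ∈ P) :
    recipSum T ≤ eulerProd P := by
  have := sum_le_prod_one_sub_inv (rpowNeg_nonneg 1) (rpowNeg_prime_lt_one one_pos) hP hT
  simpa only [rpowNeg_one, recipSum, eulerProd] using this

lemma one_le_inv_factor {p : ℕ} (hp : p.Prime) : 1 ≤ (1 - 1 / (p : ℝ))⁻¹ := by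
  have h2 : (2 : ℝ) ≤ p := by exact_mod_cast hp.two_le
  have h3 : 1 / (p : ℝ) ≤ 1 / 2 := by gcongr
  have h4 : 0 < 1 / (p : ℝ) := by positivity
  exact (one_le_inv₀ (by linarith)).2 (by linarith)

lemma eulerProd_pos {P : Finset ℕ} (hP : ∀ p ∈ P, p.Prime) : 0 < eulerProd P :=
  prod_pos fun p hp => one_pos.trans_le (one_le_inv_factor (hP p hp))

lemma one_le_eulerProd {P : Finset ℕ} (hP : ∀ p ∈ P, p.Prime) : 1 ≤ eulerProd P := by
  rw [← prod_const_one (s := P) (M := ℝ)]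
  exact prod_le_prod (fun _ _ => zero_le_one) fun p hp => one_le_inv_factor (hP p hp)

lemma eulerProd_mono {P P' : Finset ℕ} (h : P ⊆ P') (hP : ∀ p ∈ P', p.Prime) :
    eulerProd P ≤ eulerProd P' := by
  have h1 : eulerProd (P' \ P) * eulerProd P = eulerProd P' := prod_sdiff h
  rw [← h1]
  exact le_mul_of_one_le_left (eulerProd_pos fun p hp => hP p (h hp)).le
    (one_le_eulerProd fun p hp => hP p (sdiff_subset hp))

lemma primes_of_primesLE (n : ℕ) : ∀ p ∈ Nat.primesLE n, p.Prime := fun _ hp =>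
  Nat.prime_of_mem_primesLE hp

lemma recipSum_Icc_eq_harmonic (n : ℕ) : recipSum (Icc 1 n) = (harmonic n : ℝ) := by
  rw [harmonic_eq_sum_Icc]
  push_cast
  simp [recipSum]

lemma recipSum_mono {A B : Finset ℕ} (h : A ⊆ B) : recipSum A ≤ recipSum B :=
  sum_le_sum_of_subset_of_nonneg h fun _ _ _ => by positivity

lemma recipSum_nonneg (A : Finset ℕ) : 0 ≤ recipSum A := sum_nonneg fun _ _ => by positivity

lemma recipSum_Icc_le (n : ℕ) : recipSum (Icc 1 n) ≤ 1 + Real.log n := by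
  rw [recipSum_Icc_eq_harmonic]
  exact harmonic_le_one_add_log n

lemma log_le_eulerProd_primesLE (n : ℕ) : Real.log n ≤ eulerProd (Nat.primesLE n) := by
  have h1 : recipSum (Icc 1 n) ≤ eulerProd (Nat.primesLE n) := by
    refine sum_inv_le_eulerProd (primes_of_primesLE n) fun m hm => ?_
    obtain ⟨hm1, hm2⟩ := mem_Icc.1 hm
    exact ⟨by omega, fun p hp hpm =>
      Nat.mem_primesLE.2 ⟨(Nat.le_of_dvd (by omega) hpm).trans hm2, hp⟩⟩
  rw [recipSum_Icc_eq_harmonic] at h1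
  refine le_trans ?_ h1
  rcases Nat.eq_zero_or_pos n with rfl | hn
  · simp
  refine le_trans (Real.log_le_log (by exact_mod_cast hn) ?_) (log_add_one_le_harmonic n)
  exact_mod_cast Nat.le_succ n

/-- Mertens' bound for `∑ log p / p`: the primes `p ≤ n` divide `n!` to a power at least `n / p`. -/
lemma sum_log_div_le {n : ℕ} (hn : 1 ≤ n) :
    ∑ p ∈ Nat.primesLE n, Real.log p / p ≤ Real.log n + Real.log 4 := by
  have hn0 : (0 : ℝ) < n := by exact_mod_cast hn
  have hdvd : ∏ p ∈ Nat.primesLE n, p ^ (n / p) ∣ n.factorial := by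
    refine Finset.prod_dvd_of_isRelPrime ?_ ?_
    · intro p hp q hq hpq
      rw [Function.onFun, ← Nat.coprime_iff_isRelPrime]
      exact Nat.Coprime.pow _ _ ((Nat.coprime_primes (Nat.prime_of_mem_primesLE hp)
        (Nat.prime_of_mem_primesLE hq)).2 hpq)
    · intro p hp
      refine ((Nat.prime_of_mem_primesLE hp).pow_dvd_factorial_iff
        (b := Nat.log p n + 2) (by omega)).2 ?_
      have h1 : (1 : ℕ) ∈ Ico 1 (Nat.log p n + 2) := by simp
      simpa using single_le_sum (f := fun i => n / p ^ i) (fun _ _ => Nat.zero_le _) h1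
  have hle : ∏ p ∈ Nat.primesLE n, p ^ (n / p) ≤ n ^ n :=
    (Nat.le_of_dvd (Nat.factorial_pos n) hdvd).trans (Nat.factorial_le_pow n)
  have hlog : ∑ p ∈ Nat.primesLE n, ((n / p : ℕ) : ℝ) * Real.log p ≤ n * Real.log n := by
    have h1 : (∏ p ∈ Nat.primesLE n, (p : ℝ) ^ (n / p)) ≤ (n : ℝ) ^ n := by exact_mod_cast hle
    have hpos : ∀ p ∈ Nat.primesLE n, (0 : ℝ) < (p : ℝ) ^ (n / p) := fun p hp => by
      have := (Nat.prime_of_mem_primesLE hp).pos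
      positivity
    have h2 := Real.log_le_log (prod_pos hpos) h1
    rw [Real.log_prod (fun p hp => (hpos p hp).ne'), Real.log_pow] at h2
    simpa only [Real.log_pow] using h2
  have htheta : ∑ p ∈ Nat.primesLE n, Real.log p ≤ Real.log 4 * n := by
    rw [← Chebyshev.theta_eq_sum_primesLE_log]
    exact Chebyshev.theta_le_log4_mul_x hn0.le
  have hterm : ∀ p ∈ Nat.primesLE n,
      n * (Real.log p / p) ≤ ((n / p : ℕ) : ℝ) * Real.log p + Real.log p := by
    intro p hp
    have hlp : 0 ≤ Real.log p := Real.log_natCast_nonneg p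
    have h1 : (n : ℝ) / p ≤ ((n / p : ℕ) : ℝ) + 1 := by
      have hp0 : (0 : ℝ) < p := by exact_mod_cast (Nat.prime_of_mem_primesLE hp).pos
      rw [div_le_iff₀ hp0]
      exact_mod_cast (Nat.lt_mul_of_div_lt (Nat.lt_succ_self (n / p))
        (Nat.prime_of_mem_primesLE hp).pos).le
    calc (n : ℝ) * (Real.log p / p) = (n : ℝ) / p * Real.log p := by ring
      _ ≤ (((n / p : ℕ) : ℝ) + 1) * Real.log p := by gcongr
      _ = _ := by ring
  have hsum := sum_le_sum hterm
  rw [← mul_sum, sum_add_distrib] at hsum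
  have : n * ∑ p ∈ Nat.primesLE n, Real.log p / p ≤ n * (Real.log n + Real.log 4) := by
    linarith
  exact le_of_mul_le_mul_left this hn0

lemma sum_rpowNeg_le {η : ℝ} (hη : 0 < η) {T : Finset ℕ} (hT : ∀ m ∈ T, m ≠ 0) :
    ∑ m ∈ T, rpowNeg (1 + η) m ≤ 1 + 1 / η := by
  -- Comparison with the integral of `x ^ (-1 - η)`, in a form that allows induction.
  have key : ∀ k : ℕ, ∑ m ∈ range (k + 1), rpowNeg (1 + η) (m + 1) ≤
      1 + 1 / η - (1 / η) * ((k + 1 : ℕ) : ℝ) ^ (-η) := by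
    intro k
    induction k with
    | zero => simp
    | succ k ih =>
      rw [sum_range_succ]
      set x : ℝ := ((k + 1 : ℕ) : ℝ) with hx
      have hx1 : (1 : ℝ) ≤ x := by rw [hx]; exact_mod_cast Nat.succ_pos k
      have hxx : ((k + 1 + 1 : ℕ) : ℝ) = x + 1 := by rw [hx]; push_cast; ring
      have hy : 0 < x + 1 := by linarith
      rw [rpowNeg_apply, hxx]
      have h1 : (x + 1) ^ (-(1 + η)) = (x + 1) ^ (-η) * (1 / (x + 1)) := by
        rw [show -(1 + η) = -η + -1 by ring, Real.rpow_add hy, Real.rpow_neg_one, one_div]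
      have h2 : (x + 1) ^ (-η) * (1 + η / (x + 1)) ≤ x ^ (-η) := by
        have h3 : Real.log x ≤ Real.log (x + 1) - 1 / (x + 1) := by
          have := Real.log_le_sub_one_of_pos (show 0 < x / (x + 1) by positivity)
          rw [Real.log_div (by positivity) hy.ne'] at this
          have h4 : x / (x + 1) - 1 = -(1 / (x + 1)) := by field_simp; ring
          linarith
        calc (x + 1) ^ (-η) * (1 + η / (x + 1))
            ≤ (x + 1) ^ (-η) * Real.exp (η / (x + 1)) := by
              gcongr
              linarith [Real.add_one_le_exp (η / (x + 1))]
          _ = Real.exp (-η * (Real.log (x + 1) - 1 / (x + 1))) := by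
              rw [Real.rpow_def_of_pos hy, ← Real.exp_add]
              congr 1
              ring
          _ ≤ Real.exp (-η * Real.log x) := by
              apply Real.exp_le_exp.2
              nlinarith
          _ = x ^ (-η) := by
              rw [Real.rpow_def_of_pos (by linarith)]
              congr 1
              ring
      rw [h1]
      have h5 : (x + 1) ^ (-η) * (1 / (x + 1)) ≤ 1 / η * (x ^ (-η) - (x + 1) ^ (-η)) := by
        have h6 : η * ((x + 1) ^ (-η) * (1 / (x + 1))) ≤ x ^ (-η) - (x + 1) ^ (-η) := by
          have : (x + 1) ^ (-η) * (1 + η / (x + 1)) =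
            (x + 1) ^ (-η) + η * ((x + 1) ^ (-η) * (1 / (x + 1))) := by ring
          linarith
        rw [one_div_mul_eq_div, le_div_iff₀ hη]
        linarith
      linarith
  have hsub : T ⊆ (range (T.sup id + 1)).image (· + 1) := by
    intro m hm
    have h1 : m ≤ T.sup id := le_sup (f := id) hm
    have h2 := hT m hm
    exact mem_image.2 ⟨m - 1, mem_range.2 (by omega), by omega⟩
  calc ∑ m ∈ T, rpowNeg (1 + η) m
      ≤ ∑ m ∈ (range (T.sup id + 1)).image (· + 1), rpowNeg (1 + η) m :=
        sum_le_sum_of_subset_of_nonneg hsub fun i _ _ => rpowNeg_nonneg _ i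
    _ = ∑ m ∈ range (T.sup id + 1), rpowNeg (1 + η) (m + 1) :=
        sum_image fun a _ b _ h => by simpa using h
    _ ≤ 1 + 1 / η - (1 / η) * ((T.sup id + 1 : ℕ) : ℝ) ^ (-η) := key _
    _ ≤ 1 + 1 / η := by
        have : 0 ≤ (1 / η) * ((T.sup id + 1 : ℕ) : ℝ) ^ (-η) := by positivity
        linarith

/-- The upper bound in Mertens' product theorem. The product is compared with the Euler product of
`ζ(1 + 1 / log n)`, whose value is `O(log n)`. -/
lemma eulerProd_primesLE_le {n : ℕ} (hn : 2 ≤ n) :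
    eulerProd (Nat.primesLE n) ≤ 1300 * Real.log n := by
  have hlog2 : (0.69 : ℝ) < Real.log 2 := by linarith [Real.log_two_gt_d9]
  have hln : Real.log 2 ≤ Real.log n := Real.log_le_log two_pos (by exact_mod_cast hn)
  have hln0 : 0 < Real.log n := by linarith
  set η : ℝ := 1 / Real.log n with hη
  have hη0 : 0 < η := by positivity
  have h1 : ∏ p ∈ Nat.primesLE n, (1 - rpowNeg (1 + η) p)⁻¹ ≤ 1 + 1 / η :=
    prod_one_sub_inv_le_of_sum_le (rpowNeg_nonneg _) (rpowNeg_prime_lt_one (by linarith))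
      (primes_of_primesLE n) fun T hT => sum_rpowNeg_le hη0 hT
  have h2 : eulerProd (Nat.primesLE n) ≤ ∏ p ∈ Nat.primesLE n,
      (1 - rpowNeg (1 + η) p)⁻¹ * Real.exp (2 * η * (Real.log p / p)) := by
    refine prod_le_prod (fun p hp => zero_le_one.trans
      (one_le_inv_factor (Nat.prime_of_mem_primesLE hp))) fun p hp => ?_
    have hpp := Nat.prime_of_mem_primesLE hp
    have hp2 : (2 : ℝ) ≤ p := by exact_mod_cast hpp.two_le
    have hp0 : (0 : ℝ) < p := by linarith
    have hlt := rpowNeg_prime_lt_one (show 0 < 1 + η by linarith) hpp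
    have hhalf : 1 / (p : ℝ) ≤ 1 / 2 := by gcongr
    have hsplit : rpowNeg (1 + η) p = (1 / (p : ℝ)) * Real.exp (-(η * Real.log p)) := by
      rw [rpowNeg_apply, show -(1 + η) = -1 + -η by ring, Real.rpow_add hp0, Real.rpow_neg_one,
        one_div, Real.rpow_def_of_pos hp0]
      congr 2
      ring
    have hexp : 1 - η * Real.log p ≤ Real.exp (-(η * Real.log p)) := by
      linarith [Real.add_one_le_exp (-(η * Real.log p))]
    have hlp : 0 ≤ Real.log p := Real.log_natCast_nonneg p
    rw [inv_eq_one_div, div_le_iff₀ (by linarith), inv_eq_one_div, mul_assoc, one_div_mul_eq_div,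
      le_div_iff₀ (by linarith), one_mul, hsplit]
    set E := Real.exp (-(η * Real.log p))
    set t : ℝ := 1 / (p : ℝ) with ht
    have ht0 : 0 < t := by positivity
    have h3 : 1 + 2 * η * (Real.log p / p) ≤ Real.exp (2 * η * (Real.log p / p)) := by
      linarith [Real.add_one_le_exp (2 * η * (Real.log p / p))]
    have h4 : Real.log p / p = t * Real.log p := by rw [ht]; ring
    rw [h4] at h3 ⊢
    have hz : 0 ≤ t * (η * Real.log p) := by positivity
    calc 1 - t * E ≤ 1 - t * (1 - η * Real.log p) := by gcongr
      _ ≤ (1 + 2 * η * (t * Real.log p)) * (1 - t) := by nlinarith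
      _ ≤ _ := by
          apply mul_le_mul_of_nonneg_right h3
          linarith
  rw [prod_mul_distrib, ← Real.exp_sum, ← mul_sum] at h2
  have h3 := sum_log_div_le (n := n) (by omega)
  have h4 : Real.log 4 = 2 * Real.log 2 := by
    rw [show (4 : ℝ) = 2 ^ 2 by norm_num, Real.log_pow]; norm_num
  have h5 : 2 * η * ∑ p ∈ Nat.primesLE n, Real.log p / p ≤ 6 := by
    calc 2 * η * ∑ p ∈ Nat.primesLE n, Real.log p / p
        ≤ 2 * η * (3 * Real.log n) := by gcongr; linarith
      _ = 6 := by rw [hη]; field_simp; norm_num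
  have h6 : Real.exp 6 ≤ 405 := by
    have : Real.exp 6 = Real.exp 1 ^ 6 := by rw [← Real.exp_nat_mul]; norm_num
    rw [this]
    have h7 : Real.exp 1 ≤ 2.719 := by linarith [Real.exp_one_lt_d9]
    calc Real.exp 1 ^ 6 ≤ 2.719 ^ 6 := by gcongr
      _ ≤ 405 := by norm_num
  have h7 : 1 + 1 / η ≤ 3 * Real.log n := by
    rw [hη, one_div_one_div]
    linarith
  calc eulerProd (Nat.primesLE n) ≤ _ := h2
    _ ≤ (3 * Real.log n) * 405 := by
        refine mul_le_mul (h1.trans h7) ((Real.exp_le_exp.2 h5).trans h6) (Real.exp_pos _).le ?_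
        positivity
    _ ≤ 1300 * Real.log n := by linarith

/-! ### The characteristic function of a random subset -/

/-- `cis θ = exp(2πiθ)`. -/
noncomputable def cis (θ : ℝ) : ℂ := Complex.exp ((2 * Real.pi * θ : ℝ) * Complex.I)

lemma cis_add (a b : ℝ) : cis (a + b) = cis a * cis b := by
  rw [cis, cis, cis, ← Complex.exp_add]
  congr 1
  push_cast
  ring

lemma cis_zero : cis 0 = 1 := by simp [cis]

lemma cis_int (z : ℤ) : cis z = 1 := by
  rw [cis, Complex.exp_eq_one_iff]
  exact ⟨z, by push_cast; ring⟩

lemma cis_re (θ : ℝ) : (cis θ).re = Real.cos (2 * Real.pi * θ) := Complex.exp_ofReal_mul_I_re _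

lemma cis_im (θ : ℝ) : (cis θ).im = Real.sin (2 * Real.pi * θ) := Complex.exp_ofReal_mul_I_im _

lemma cis_sum {ι : Type*} (s : Finset ι) (f : ι → ℝ) : cis (∑ i ∈ s, f i) = ∏ i ∈ s, cis (f i) := by
  classical
  induction s using Finset.induction_on with
  | empty => simp [cis_zero]
  | insert a s ha ih => rw [sum_insert ha, prod_insert ha, cis_add, ih]

/-- The value at `θ` of the characteristic function of a random variable that is `1` with
probability `p` and `0` otherwise, for the frequency normalised to `2πθ`. -/
noncomputable def bernoulliChar (p θ : ℝ) : ℂ := ((1 - p : ℝ) : ℂ) + (p : ℂ) * cis θ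

/-- The expectation of `cis (t * R(S))`, where `S` is the random subset of `A` that contains each
element independently with probability `p`. -/
noncomputable def charFun (A : Finset ℕ) (p t : ℝ) : ℂ := ∏ n ∈ A, bernoulliChar p (t / n)

/-- The probability that the random subset of `A` is `S`. -/
noncomputable def weight (A : Finset ℕ) (p : ℝ) (S : Finset ℕ) : ℝ :=
  (∏ _n ∈ S, p) * ∏ _n ∈ A \ S, (1 - p)

lemma weight_nonneg {p : ℝ} (hp0 : 0 ≤ p) (hp1 : p ≤ 1) (A S : Finset ℕ) : 0 ≤ weight A p S :=
  mul_nonneg (prod_nonneg fun _ _ => hp0) (prod_nonneg fun _ _ => by linarith)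

lemma charFun_eq_sum (A : Finset ℕ) (p t : ℝ) :
    charFun A p t = ∑ S ∈ A.powerset, (weight A p S : ℂ) * cis (t * recipSum S) := by
  have h : charFun A p t = ∏ n ∈ A, ((p : ℂ) * cis (t / n) + ((1 - p : ℝ) : ℂ)) :=
    prod_congr rfl fun n _ => add_comm _ _
  rw [h, prod_add]
  refine sum_congr rfl fun S _ => ?_
  rw [prod_mul_distrib, ← cis_sum, weight, recipSum, mul_sum]
  push_cast
  simp only [div_eq_mul_inv, one_mul]
  ring

lemma norm_bernoulliChar_le {p θ δ : ℝ} (hp0 : 0 ≤ p) (hp : p ≤ 1 / 2) (hδ : 0 ≤ δ)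
    (h : ∀ z : ℤ, δ ≤ |θ - z|) : ‖bernoulliChar p θ‖ ≤ Real.exp (-4 * p * δ ^ 2) := by
  obtain ⟨z, hz⟩ : ∃ z : ℤ, |θ - z| ≤ 1 / 2 := ⟨round θ, abs_sub_round θ⟩
  have hcis : cis θ = cis (θ - z) := by
    conv_lhs => rw [show θ = (θ - z) + z by ring, cis_add, cis_int, mul_one]
  set x := θ - z with hx
  have hcos : Real.cos (2 * Real.pi * x) ≤ 1 - 8 * x ^ 2 := by
    have h1 : |2 * Real.pi * x| ≤ Real.pi := by
      rw [abs_mul, abs_of_pos Real.two_pi_pos]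
      nlinarith [Real.pi_pos]
    refine (Real.cos_le_one_sub_mul_cos_sq h1).trans (le_of_eq ?_)
    field_simp
    ring
  have hx2 : δ ^ 2 ≤ x ^ 2 := by
    rw [← sq_abs x]
    exact pow_le_pow_left₀ hδ (h z) 2
  have hsq : ‖bernoulliChar p θ‖ ^ 2 =
      1 - 2 * p * (1 - p) * (1 - Real.cos (2 * Real.pi * x)) := by
    rw [← Complex.normSq_eq_norm_sq, Complex.normSq_apply, bernoulliChar, hcis]
    simp only [Complex.add_re, Complex.add_im, Complex.re_ofReal_mul, Complex.im_ofReal_mul,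
      Complex.ofReal_re, Complex.ofReal_im, cis_re, cis_im]
    linear_combination p ^ 2 * Real.sin_sq_add_cos_sq (2 * Real.pi * x)
  have hle : ‖bernoulliChar p θ‖ ^ 2 ≤ Real.exp (-4 * p * δ ^ 2) ^ 2 := by
    rw [hsq, ← Real.exp_nat_mul]
    have h1 := Real.add_one_le_exp ((2 : ℕ) * (-4 * p * δ ^ 2))
    have h2 : 8 * δ ^ 2 ≤ 1 - Real.cos (2 * Real.pi * x) := by linarith
    have h3 : p ≤ 2 * p * (1 - p) := by nlinarith
    have h4 : p * (8 * δ ^ 2) ≤ 2 * p * (1 - p) * (1 - Real.cos (2 * Real.pi * x)) :=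
      mul_le_mul h3 h2 (by positivity) (hp0.trans h3)
    push_cast at h1 ⊢
    linarith
  exact le_of_sq_le_sq hle (Real.exp_pos _).le

lemma norm_bernoulliChar_le_one {p θ : ℝ} (hp0 : 0 ≤ p) (hp : p ≤ 1 / 2) :
    ‖bernoulliChar p θ‖ ≤ 1 := by
  simpa using norm_bernoulliChar_le (θ := θ) hp0 hp le_rfl fun z => abs_nonneg _

lemma norm_charFun_le {A B : Finset ℕ} (hB : B ⊆ A) {p t : ℝ} {δ : ℕ → ℝ} (hp0 : 0 ≤ p)
    (hp : p ≤ 1 / 2) (hδ : ∀ n ∈ B, 0 ≤ δ n) (h : ∀ n ∈ B, ∀ z : ℤ, δ n ≤ |t / n - z|) :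
    ‖charFun A p t‖ ≤ Real.exp (-4 * p * ∑ n ∈ B, δ n ^ 2) := by
  rw [charFun, norm_prod, ← prod_sdiff hB, mul_sum, Real.exp_sum]
  have h1 : ∏ n ∈ A \ B, ‖bernoulliChar p (t / n)‖ ≤ 1 :=
    prod_le_one (fun _ _ => norm_nonneg _) fun _ _ => norm_bernoulliChar_le_one hp0 hp
  have h2 : ∏ n ∈ B, ‖bernoulliChar p (t / n)‖ ≤ ∏ n ∈ B, Real.exp (-4 * p * δ n ^ 2) :=
    prod_le_prod (fun _ _ => norm_nonneg _) fun n hn =>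
      norm_bernoulliChar_le hp0 hp (hδ n hn) (h n hn)
  calc _ ≤ 1 * ∏ n ∈ B, Real.exp (-4 * p * δ n ^ 2) :=
        mul_le_mul h1 h2 (prod_nonneg fun _ _ => norm_nonneg _) zero_le_one
    _ = _ := one_mul _

lemma abs_sin_sub_self_le (x : ℝ) : |Real.sin x - x| ≤ |x| ^ 3 / 6 := by
  have key : ∀ y : ℝ, 0 < y → |Real.sin y - y| ≤ |y| ^ 3 / 6 := fun y hy => by
    have h1 := Real.sin_gt_sub_cube hy
    have h2 := Real.sin_lt hy
    rw [abs_of_neg (by linarith), abs_of_pos hy]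
    linarith
  rcases lt_trichotomy x 0 with hx | rfl | hx
  · have := key (-x) (by linarith)
    rw [Real.sin_neg, abs_neg, show -Real.sin x - -x = -(Real.sin x - x) by ring, abs_neg] at this
    exact this
  · simp
  · exact key x hx

/-- After subtracting its mean, a Bernoulli variable has a characteristic function that is real up
to a cubic error. -/
lemma abs_arg_centred_le {p θ : ℝ} (hp0 : 0 ≤ p) (hp : p ≤ 1 / 2) (hθ : 7 * |θ| ≤ 1) :
    |(bernoulliChar p θ * cis (-(p * θ))).arg| ≤ 42 * Real.pi * (p * |θ| ^ 3) := by
  set z := bernoulliChar p θ * cis (-(p * θ)) with hz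
  have hz' : z = ((1 - p : ℝ) : ℂ) * cis (-(p * θ)) + (p : ℂ) * cis ((1 - p) * θ) := by
    rw [hz, bernoulliChar, add_mul, mul_assoc, ← cis_add]
    congr 3
    ring
  set a := 2 * Real.pi * (-(p * θ)) with ha
  set b := 2 * Real.pi * ((1 - p) * θ) with hb
  have hre : z.re = (1 - p) * Real.cos a + p * Real.cos b := by
    rw [hz']
    simp only [Complex.add_re, Complex.re_ofReal_mul, cis_re, ha, hb]
  have him : z.im = (1 - p) * (Real.sin a - a) + p * (Real.sin b - b) := by
    rw [hz']
    simp only [Complex.add_im, Complex.im_ofReal_mul, cis_im]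
    rw [← ha, ← hb]
    have : (1 - p) * a + p * b = 0 := by rw [ha, hb]; ring
    linarith
  set y := 2 * Real.pi * |θ| with hy
  have hpi := Real.pi_pos
  have hpi4 := Real.pi_lt_d2
  have hθ0 := abs_nonneg θ
  have hy0 : 0 ≤ y := by positivity
  have hy1 : y ≤ 1 := by
    rw [hy]
    nlinarith
  have haa : |a| = p * y := by
    rw [ha, abs_mul, abs_of_pos Real.two_pi_pos, abs_neg, abs_mul, abs_of_nonneg hp0, hy]
    ring
  have hbb : |b| = (1 - p) * y := by
    rw [hb, abs_mul, abs_of_pos Real.two_pi_pos, abs_mul, abs_of_nonneg (by linarith : 0 ≤ 1 - p),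
      hy]
    ring
  have hcos : ∀ x : ℝ, |x| ≤ 1 → 1 / 2 ≤ Real.cos x := fun x hx => by
    have h1 := Real.one_sub_sq_div_two_le_cos (x := x)
    have h2 : x ^ 2 ≤ 1 := by
      rw [← sq_abs]
      exact pow_le_one₀ (abs_nonneg x) hx
    linarith
  have hca := hcos a (by rw [haa]; nlinarith)
  have hcb := hcos b (by rw [hbb]; nlinarith)
  have hre2 : 1 / 2 ≤ z.re := by
    rw [hre]
    nlinarith
  have hnorm : 1 / 2 ≤ ‖z‖ := hre2.trans (Complex.re_le_norm z)
  have himle : |z.im| ≤ 42 * (p * |θ| ^ 3) := by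
    have h1 : |z.im| ≤ (1 - p) * ((p * y) ^ 3 / 6) + p * (((1 - p) * y) ^ 3 / 6) := by
      rw [him, ← haa, ← hbb]
      refine (abs_add_le _ _).trans (add_le_add ?_ ?_)
      · rw [abs_mul, abs_of_nonneg (by linarith : 0 ≤ 1 - p)]
        exact mul_le_mul_of_nonneg_left (abs_sin_sub_self_le a) (by linarith)
      · rw [abs_mul, abs_of_nonneg hp0]
        exact mul_le_mul_of_nonneg_left (abs_sin_sub_self_le b) hp0
    have h2 : (1 - p) * ((p * y) ^ 3 / 6) + p * (((1 - p) * y) ^ 3 / 6) =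
        p * y ^ 3 / 6 * ((1 - p) * (p ^ 2 + (1 - p) ^ 2)) := by ring
    have h3 : (1 - p) * (p ^ 2 + (1 - p) ^ 2) ≤ 1 := by
      have : p ^ 2 + (1 - p) ^ 2 ≤ 1 := by nlinarith
      nlinarith [sq_nonneg p, sq_nonneg (1 - p)]
    have h4 : p * y ^ 3 / 6 * ((1 - p) * (p ^ 2 + (1 - p) ^ 2)) ≤ p * y ^ 3 / 6 :=
      mul_le_of_le_one_right (by positivity) h3
    have h5 : y ^ 3 ≤ 252 * |θ| ^ 3 := by
      rw [hy, mul_pow]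
      gcongr
      calc (2 * Real.pi) ^ 3 ≤ (2 * 3.15) ^ 3 := by gcongr
        _ ≤ 252 := by norm_num
    rw [h2] at h1
    have h6 : p * y ^ 3 ≤ p * (252 * |θ| ^ 3) := mul_le_mul_of_nonneg_left h5 hp0
    linarith
  have harg := Complex.abs_arg_le_pi_div_two_iff.2 (show 0 ≤ z.re by linarith)
  have hsin := Real.mul_abs_le_abs_sin harg
  have hprod : ‖z‖ * |Real.sin z.arg| = |z.im| := by
    rw [← Complex.norm_mul_sin_arg, abs_mul, abs_norm]
  have h7 : |Real.sin z.arg| ≤ 2 * |z.im| := by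
    rw [← hprod]
    nlinarith [abs_nonneg (Real.sin z.arg)]
  have h8 : |z.arg| = Real.pi / 2 * (2 / Real.pi * |z.arg|) := by field_simp
  rw [h8]
  calc Real.pi / 2 * (2 / Real.pi * |z.arg|) ≤ Real.pi / 2 * (2 * (42 * (p * |θ| ^ 3))) :=
        mul_le_mul_of_nonneg_left (by linarith) (by positivity)
    _ = _ := by ring

lemma re_prod_nonneg {ι : Type*} (s : Finset ι) (z : ι → ℂ)
    (h : ∑ i ∈ s, |(z i).arg| ≤ Real.pi / 2) : 0 ≤ (∏ i ∈ s, z i).re := by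
  have h1 : ∏ i ∈ s, z i =
      ((∏ i ∈ s, ‖z i‖ : ℝ) : ℂ) * Complex.exp (((∑ i ∈ s, (z i).arg : ℝ) : ℂ) * Complex.I) := by
    push_cast
    rw [sum_mul, Complex.exp_sum, ← prod_mul_distrib]
    exact prod_congr rfl fun i _ => (Complex.norm_mul_exp_arg_mul_I _).symm
  rw [h1, Complex.re_ofReal_mul, Complex.exp_ofReal_mul_I_re]
  refine mul_nonneg (prod_nonneg fun _ _ => norm_nonneg _) (Real.cos_nonneg_of_mem_Icc ?_)
  exact abs_le.1 ((abs_sum_le_sum_abs _ _).trans h)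

/-- The random subset has mean reciprocal sum `1`, so at a small integer frequency `h` the mean
contributes the phase `cis h = 1`, and the rest of the phase is cubic in `h`. -/
lemma re_charFun_nonneg {A : Finset ℕ} {p M H : ℝ} (hp0 : 0 ≤ p) (hp : p ≤ 1 / 2)
    (hpA : p * recipSum A = 1) (hM : 0 < M) (hA : ∀ n ∈ A, M ≤ (n : ℝ)) {h : ℤ}
    (hh : |(h : ℝ)| ≤ H) (hHM : 7 * H ≤ M) (hHM3 : 84 * H ^ 3 ≤ M ^ 2) :
    0 ≤ (charFun A p h).re := by
  have h1 : charFun A p h =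
      ∏ n ∈ A, bernoulliChar p ((h : ℝ) / n) * cis (-(p * ((h : ℝ) / n))) := by
    rw [prod_mul_distrib, ← cis_sum]
    have : ∑ n ∈ A, -(p * ((h : ℝ) / n)) = ((-h : ℤ) : ℝ) := by
      have h2 : ∑ n ∈ A, -(p * ((h : ℝ) / n)) = -(h : ℝ) * (p * recipSum A) := by
        rw [recipSum, mul_sum, mul_sum]
        exact sum_congr rfl fun n _ => by ring
      rw [h2, hpA]
      push_cast
      ring
    rw [this, cis_int, mul_one, charFun]
  rw [h1]
  refine re_prod_nonneg _ _ ?_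
  have hterm : ∀ n ∈ A, |(bernoulliChar p ((h : ℝ) / n) * cis (-(p * ((h : ℝ) / n)))).arg| ≤
      42 * Real.pi * (H ^ 3 / M ^ 2) * (p * (1 / (n : ℝ))) := by
    intro n hn
    have hMn := hA n hn
    have hn0 : (0 : ℝ) < n := hM.trans_le hMn
    have habs : |(h : ℝ) / n| = |(h : ℝ)| / n := by rw [abs_div, abs_of_pos hn0]
    have h2 : 7 * |(h : ℝ) / n| ≤ 1 := by
      rw [habs, ← mul_div_assoc, div_le_one hn0]
      linarith
    refine (abs_arg_centred_le hp0 hp h2).trans ?_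
    have h3 : |(h : ℝ) / n| ^ 3 ≤ H ^ 3 / M ^ 2 * (1 / (n : ℝ)) := by
      rw [habs, div_pow]
      have h4 : |(h : ℝ)| ^ 3 ≤ H ^ 3 := pow_le_pow_left₀ (abs_nonneg _) hh 3
      have h5 : M ^ 2 ≤ (n : ℝ) ^ 2 := pow_le_pow_left₀ hM.le hMn 2
      calc |(h : ℝ)| ^ 3 / (n : ℝ) ^ 3 = |(h : ℝ)| ^ 3 / (n : ℝ) ^ 2 * (1 / (n : ℝ)) := by
            field_simp
        _ ≤ H ^ 3 / M ^ 2 * (1 / (n : ℝ)) := by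
            have h6 : 0 ≤ |(h : ℝ)| ^ 3 := by positivity
            gcongr
            exact h6.trans h4
    calc 42 * Real.pi * (p * |(h : ℝ) / n| ^ 3)
        ≤ 42 * Real.pi * (p * (H ^ 3 / M ^ 2 * (1 / (n : ℝ)))) := by gcongr
      _ = _ := by ring
  refine (sum_le_sum hterm).trans ?_
  rw [← mul_sum, ← mul_sum]
  change 42 * Real.pi * (H ^ 3 / M ^ 2) * (p * recipSum A) ≤ _
  rw [hpA, mul_one]
  have h6 : H ^ 3 / M ^ 2 ≤ 1 / 84 := by
    rw [div_le_div_iff₀ (by positivity) (by norm_num)]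
    linarith
  calc 42 * Real.pi * (H ^ 3 / M ^ 2) ≤ 42 * Real.pi * (1 / 84) := by gcongr
    _ = Real.pi / 2 := by ring

/-! ### Orthogonality -/

lemma sum_cis_of_int {Q : ℕ} {r : ℝ} {z c : ℤ} (hr : r = z) :
    ∑ i ∈ range Q, cis ((((i : ℤ) - c : ℤ) : ℝ) * r) = Q := by
  have : ∀ i ∈ range Q, cis ((((i : ℤ) - c : ℤ) : ℝ) * r) = 1 := fun i _ => by
    rw [hr, ← Int.cast_mul, cis_int]
  rw [sum_congr rfl this]
  simp

lemma sum_cis_of_not_int {Q : ℕ} {r : ℝ} {a c : ℤ} (hr : Q * r = a) (h : ∀ z : ℤ, r ≠ z) :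
    ∑ i ∈ range Q, cis ((((i : ℤ) - c : ℤ) : ℝ) * r) = 0 := by
  have hne : cis r ≠ 1 := by
    rw [cis, Ne, Complex.exp_eq_one_iff]
    rintro ⟨n, hn⟩
    apply h n
    have h1 : ((2 * Real.pi * r : ℝ) : ℂ) = ((n * (2 * Real.pi) : ℝ) : ℂ) := by
      have := mul_right_cancel₀ Complex.I_ne_zero (hn.trans (mul_assoc _ _ _).symm)
      rw [this]
      push_cast
      ring
    have h2 := Complex.ofReal_injective h1
    have h3 := Real.two_pi_pos
    have : 2 * Real.pi * r = 2 * Real.pi * n := by linarith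
    exact mul_left_cancel₀ h3.ne' this
  have hpow : ∀ i : ℕ, cis ((i : ℝ) * r) = cis r ^ i := fun i => by
    induction i with
    | zero => simp [cis_zero]
    | succ k ih => rw [pow_succ, ← ih, ← cis_add]; congr 1; push_cast; ring
  have hsplit : ∀ i ∈ range Q, cis ((((i : ℤ) - c : ℤ) : ℝ) * r) =
      cis (-(c * r)) * cis r ^ i := fun i _ => by
    rw [← hpow, ← cis_add]
    congr 1
    push_cast
    ring
  rw [sum_congr rfl hsplit, ← mul_sum, geom_sum_eq hne, ← hpow, hr, cis_int]
  simp

lemma recipSum_eq_div {Q : ℕ} {S : Finset ℕ} (hQ : ∀ n ∈ S, n ∣ Q) (h0 : ∀ n ∈ S, n ≠ 0) :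
    ∃ a : ℤ, Q * recipSum S = a := by
  refine ⟨∑ n ∈ S, ((Q / n : ℕ) : ℤ), ?_⟩
  rw [recipSum, mul_sum]
  rw [Int.cast_sum]
  refine sum_congr rfl fun n hn => ?_
  rw [Int.cast_natCast, Nat.cast_div (hQ n hn) (by exact_mod_cast h0 n hn)]
  ring

/-! ### Large deviations -/

/-- Chernoff's bound, with the exponential moment at `M / 2`. -/
lemma sum_weight_two_le_recipSum_le {A : Finset ℕ} {p M : ℝ} (hp0 : 0 ≤ p) (hp1 : p ≤ 1)
    (hpA : p * recipSum A = 1) (hM : 0 < M) (hA : ∀ n ∈ A, M ≤ (n : ℝ)) :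
    ∑ S ∈ A.powerset with 2 ≤ recipSum S, weight A p S ≤ Real.exp (-M / 4) := by
  set t := M / 2 with ht
  have hmgf : ∑ S ∈ A.powerset, weight A p S * Real.exp (t * recipSum S) =
      ∏ n ∈ A, (p * Real.exp (t / n) + (1 - p)) := by
    rw [prod_add]
    refine sum_congr rfl fun S _ => ?_
    rw [prod_mul_distrib, ← Real.exp_sum, weight, recipSum, mul_sum]
    simp only [div_eq_mul_inv, one_mul]
    ring
  have hprod : ∏ n ∈ A, (p * Real.exp (t / n) + (1 - p)) ≤ Real.exp (3 * M / 4) := by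
    calc ∏ n ∈ A, (p * Real.exp (t / n) + (1 - p))
        ≤ ∏ n ∈ A, Real.exp (3 * M / 4 * (p * (1 / (n : ℝ)))) := by
          refine prod_le_prod (fun n _ => ?_) fun n hn => ?_
          · have := Real.exp_pos (t / n)
            nlinarith [mul_nonneg hp0 this.le]
          · have hMn := hA n hn
            have hn0 : (0 : ℝ) < n := hM.trans_le hMn
            have hy : t / n ≤ 1 / 2 := by
              rw [ht, div_div, div_le_div_iff₀ (by positivity) two_pos]
              linarith
            have hy0 : 0 ≤ t / n := by positivity
            have h1 := abs_le.1 (Real.abs_exp_sub_one_sub_id_le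
              (x := t / n) (by rw [abs_of_nonneg hy0]; linarith))
            have h2 : Real.exp (t / n) - 1 ≤ 3 / 2 * (t / n) := by nlinarith [h1.2]
            have h3 : 3 / 2 * (t / n) = 3 * M / 4 * (1 / (n : ℝ)) := by rw [ht]; ring
            have h4 := Real.add_one_le_exp (3 * M / 4 * (p * (1 / (n : ℝ))))
            rw [h3] at h2
            have h5 := mul_le_mul_of_nonneg_left h2 hp0
            linarith
      _ = Real.exp (3 * M / 4) := by
          rw [← Real.exp_sum, ← mul_sum, ← mul_sum]
          change Real.exp (3 * M / 4 * (p * recipSum A)) = _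
          rw [hpA, mul_one]
  have hmarkov : Real.exp (2 * t) * ∑ S ∈ A.powerset with 2 ≤ recipSum S, weight A p S ≤
      ∑ S ∈ A.powerset, weight A p S * Real.exp (t * recipSum S) := by
    rw [mul_sum]
    calc _ ≤ ∑ S ∈ A.powerset with 2 ≤ recipSum S, weight A p S * Real.exp (t * recipSum S) := by
          refine sum_le_sum fun S hS => ?_
          rw [mul_comm]
          refine mul_le_mul_of_nonneg_left (Real.exp_le_exp.2 ?_) (weight_nonneg hp0 hp1 A S)
          have := (mem_filter.1 hS).2
          have ht0 : 0 < t := by positivity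
          nlinarith
      _ ≤ _ := sum_le_sum_of_subset_of_nonneg (filter_subset _ _) fun S _ _ =>
          mul_nonneg (weight_nonneg hp0 hp1 A S) (Real.exp_pos _).le
  rw [hmgf] at hmarkov
  have h1 := hmarkov.trans hprod
  have h2 : Real.exp (3 * M / 4) = Real.exp (2 * t) * Real.exp (-M / 4) := by
    rw [← Real.exp_add]
    congr 1
    rw [ht]
    ring
  rw [h2] at h1
  exact le_of_mul_le_mul_left h1 (Real.exp_pos _)

lemma weight_empty_le {A : Finset ℕ} {p M : ℝ} (hp0 : 0 ≤ p) (hp1 : p ≤ 1)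
    (hpA : p * recipSum A = 1) (hM : 0 < M) (hA : ∀ n ∈ A, M ≤ (n : ℝ)) :
    weight A p ∅ ≤ Real.exp (-M / 4) := by
  have hcard : M * recipSum A ≤ #A := by
    rw [recipSum, mul_sum, card_eq_sum_ones]
    push_cast
    refine sum_le_sum fun n hn => ?_
    have hMn := hA n hn
    rw [mul_one_div, div_le_one (hM.trans_le hMn)]
    exact hMn
  have h1 : weight A p ∅ = (1 - p) ^ #A := by simp [weight]
  rw [h1]
  calc (1 - p) ^ #A ≤ Real.exp (-p) ^ #A := by
        refine pow_le_pow_left₀ (by linarith) ?_ _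
        linarith [Real.add_one_le_exp (-p)]
    _ = Real.exp (-(p * #A)) := by rw [← Real.exp_nat_mul]; congr 1; ring
    _ ≤ Real.exp (-M / 4) := by
        refine Real.exp_le_exp.2 ?_
        have h2 : M * (p * recipSum A) ≤ p * #A := by
          calc M * (p * recipSum A) = p * (M * recipSum A) := by ring
            _ ≤ _ := mul_le_mul_of_nonneg_left hcard hp0
        rw [hpA] at h2
        linarith

/-- If no subset of `A` has reciprocal sum `1`, then the random reciprocal sum is an integer only
when it is far from its mean. -/
lemma sum_re_charFun_le {A : Finset ℕ} {p M : ℝ} (hp0 : 0 ≤ p) (hp1 : p ≤ 1)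
    (hpA : p * recipSum A = 1) (hM : 0 < M) (hA : ∀ n ∈ A, M ≤ (n : ℝ)) {Q : ℕ} (c : ℤ)
    (hQ : ∀ n ∈ A, n ∣ Q) (hno : ∀ S ⊆ A, recipSum S ≠ 1) :
    ∑ i ∈ range Q, (charFun A p (((i : ℤ) - c : ℤ) : ℝ)).re ≤ Q * (2 * Real.exp (-M / 4)) := by
  have hA0 : ∀ n ∈ A, n ≠ 0 := fun n hn => by
    have := hM.trans_le (hA n hn)
    exact_mod_cast this.ne'
  have hswap : ∑ i ∈ range Q, charFun A p (((i : ℤ) - c : ℤ) : ℝ) =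
      ∑ S ∈ A.powerset, (weight A p S : ℂ) *
        ∑ i ∈ range Q, cis ((((i : ℤ) - c : ℤ) : ℝ) * recipSum S) := by
    simp only [charFun_eq_sum, mul_sum]
    exact sum_comm
  rw [← Complex.re_sum, hswap, Complex.re_sum]
  have hterm : ∀ S ∈ A.powerset, ((weight A p S : ℂ) *
        ∑ i ∈ range Q, cis ((((i : ℤ) - c : ℤ) : ℝ) * recipSum S)).re ≤
      Q * ((if S = ∅ then weight A p S else 0) +
        (if 2 ≤ recipSum S then weight A p S else 0)) := by
    intro S hS
    have hSA := mem_powerset.1 hS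
    have hw := weight_nonneg hp0 hp1 A S
    have hr0 : 0 ≤ (if S = ∅ then weight A p S else 0) +
        (if 2 ≤ recipSum S then weight A p S else 0) := by
      split_ifs <;> linarith
    rw [Complex.re_ofReal_mul]
    by_cases hint : ∃ z : ℤ, recipSum S = z
    · obtain ⟨z, hz⟩ := hint
      rw [sum_cis_of_int hz, Complex.natCast_re, mul_comm]
      refine mul_le_mul_of_nonneg_left ?_ (Nat.cast_nonneg Q)
      by_cases hSe : S = ∅
      · rw [if_pos hSe]
        split_ifs <;> linarith
      · have hpos : 0 < recipSum S := by
          refine sum_pos (fun n hn => ?_) (nonempty_iff_ne_empty.2 hSe)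
          have := hM.trans_le (hA n (hSA hn))
          positivity
        have h1 : recipSum S ≠ 1 := hno S hSA
        have h2 : 2 ≤ recipSum S := by
          rw [hz] at hpos h1 ⊢
          have h3 : 0 < z := by exact_mod_cast hpos
          have h4 : z ≠ 1 := by exact_mod_cast h1
          have h5 : 2 ≤ z := by omega
          exact_mod_cast h5
        rw [if_neg hSe, if_pos h2]
        linarith
    · obtain ⟨a, ha⟩ := recipSum_eq_div (Q := Q) (fun n hn => hQ n (hSA hn))
        (fun n hn => hA0 n (hSA hn))
      rw [sum_cis_of_not_int ha (fun z hz => hint ⟨z, hz⟩), Complex.zero_re, mul_zero]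
      positivity
  refine (sum_le_sum hterm).trans ?_
  rw [← mul_sum, sum_add_distrib, ← sum_filter, ← sum_filter]
  refine mul_le_mul_of_nonneg_left ?_ (Nat.cast_nonneg Q)
  have h1 : ∑ S ∈ A.powerset with S = ∅, weight A p S = weight A p ∅ := by
    rw [filter_eq' A.powerset ∅, if_pos (empty_mem_powerset A), sum_singleton]
  rw [h1]
  linarith [weight_empty_le hp0 hp1 hpA hM hA, sum_weight_two_le_recipSum_le hp0 hp1 hpA hM hA]

/-! ### The circle method -/

/-- The elements of `A` that are divisible by `q`. -/
def multiplesIn (A : Finset ℕ) (q : ℕ) : Finset ℕ := A.filter (q ∣ ·)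

/-- The prime powers that divide some element of `A`; they need not divide it exactly. -/
noncomputable def primePowDivisors (A : Finset ℕ) : Finset ℕ := by
  classical exact (A.biUnion Nat.divisors).filter IsPrimePow

open Classical in
/-- The elements of `A` that divide some integer in the interval of length `K` centred at `h`. -/
noncomputable def nearDivisors (A : Finset ℕ) (K : ℝ) (h : ℤ) : Finset ℕ :=
  A.filter fun n => ∃ x : ℤ, |(x : ℝ) - h| ≤ K / 2 ∧ (n : ℤ) ∣ x

open Classical in
/-- The prime powers `q` for which at least half of the elements of `A` divisible by `q`, weighted
by reciprocals, divide some integer in the interval of length `K` centred at `h`. -/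
noncomputable def richPrimePows (A : Finset ℕ) (K : ℝ) (h : ℤ) : Finset ℕ :=
  (primePowDivisors A).filter fun q =>
    recipSum (multiplesIn A q) ≤ 2 * recipSum (multiplesIn (nearDivisors A K h) q)

lemma mem_multiplesIn {A : Finset ℕ} {q n : ℕ} : n ∈ multiplesIn A q ↔ n ∈ A ∧ q ∣ n := mem_filter

lemma mem_primePowDivisors {A : Finset ℕ} (hA : ∀ n ∈ A, n ≠ 0) {q : ℕ} :
    q ∈ primePowDivisors A ↔ IsPrimePow q ∧ ∃ n ∈ A, q ∣ n := by
  classical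
  simp only [primePowDivisors, mem_filter, mem_biUnion, Nat.mem_divisors]
  constructor
  · rintro ⟨⟨n, hn, hq, -⟩, h⟩
    exact ⟨h, n, hn, hq⟩
  · rintro ⟨h, n, hn, hq⟩
    exact ⟨⟨n, hn, hq, hA n hn⟩, h⟩

lemma isPrimePow_of_mem {A : Finset ℕ} {q : ℕ} (h : q ∈ primePowDivisors A) : IsPrimePow q := by
  classical
  exact (mem_filter.1 h).2

lemma pos_of_mem_primePowDivisors {A : Finset ℕ} {q : ℕ} (h : q ∈ primePowDivisors A) : 0 < q :=
  (isPrimePow_of_mem h).pos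

lemma mem_nearDivisors {A : Finset ℕ} {K : ℝ} {h : ℤ} {n : ℕ} : n ∈ nearDivisors A K h ↔
    n ∈ A ∧ ∃ x : ℤ, |(x : ℝ) - h| ≤ K / 2 ∧ (n : ℤ) ∣ x := by
  classical
  exact mem_filter

lemma mem_richPrimePows {A : Finset ℕ} {K : ℝ} {h : ℤ} {q : ℕ} : q ∈ richPrimePows A K h ↔
    q ∈ primePowDivisors A ∧
      recipSum (multiplesIn A q) ≤ 2 * recipSum (multiplesIn (nearDivisors A K h) q) := by
  classical
  exact mem_filter

lemma nearDivisors_subset (A : Finset ℕ) (K : ℝ) (h : ℤ) : nearDivisors A K h ⊆ A := fun _ hn =>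
  (mem_nearDivisors.1 hn).1

lemma dvd_lcm_primePowDivisors {A : Finset ℕ} (hA : ∀ n ∈ A, n ≠ 0) {n : ℕ} (hn : n ∈ A) :
    n ∣ (primePowDivisors A).lcm id := by
  rw [Nat.dvd_iff_prime_pow_dvd_dvd]
  intro p k hp hpk
  rcases Nat.eq_zero_or_pos k with rfl | hk
  · simp
  · exact dvd_lcm (f := id) ((mem_primePowDivisors hA).2
      ⟨hp.isPrimePow.pow hk.ne', n, hn, hpk⟩)

lemma lcm_primePowDivisors_pos (A : Finset ℕ) : 0 < (primePowDivisors A).lcm id := by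
  refine Nat.pos_of_ne_zero fun h => ?_
  obtain ⟨q, hq, hq0⟩ := lcm_eq_zero_iff.1 h
  exact (pos_of_mem_primePowDivisors hq).ne' hq0

lemma lcm_natCast_dvd {D : Finset ℕ} {x : ℤ} (h : ∀ q ∈ D, (q : ℤ) ∣ x) :
    ((D.lcm id : ℕ) : ℤ) ∣ x :=
  Int.natCast_dvd.2 (Finset.lcm_dvd fun q hq => Int.natCast_dvd.1 (h q hq))

lemma lcm_dvd_lcm_of_subset {D P : Finset ℕ} (h : D ⊆ P) : D.lcm id ∣ P.lcm id :=
  Finset.lcm_dvd fun _ hq => dvd_lcm (f := id) (h hq)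

/-- The number of integers of size at most about `Q` within `K / 2` of a multiple of `m`. -/
lemma card_le_of_near_multiples {T : Finset ℤ} {m Q : ℕ} (hmQ : m ∣ Q) (hQ : 0 < Q) {K : ℝ}
    (hK : 1 ≤ K)
    (hT : ∀ h ∈ T, ∃ x : ℤ, |(x : ℝ) - h| ≤ K / 2 ∧ (m : ℤ) ∣ x ∧ |x| ≤ (Q : ℤ)) :
    (#T : ℝ) ≤ 6 * K * ((Q : ℝ) / m) := by
  obtain ⟨d, rfl⟩ := hmQ
  have hm : 0 < m := Nat.pos_of_mul_pos_right hQ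
  have hd : 0 < d := Nat.pos_of_mul_pos_left hQ
  have hmR : (0 : ℝ) < m := by exact_mod_cast hm
  have hsub : T ⊆ (Icc (-(d : ℤ)) d).biUnion fun y =>
      Icc ⌈(m : ℝ) * y - K / 2⌉ ⌊(m : ℝ) * y + K / 2⌋ := by
    intro h hh
    obtain ⟨x, hx, ⟨y, rfl⟩, hxQ⟩ := hT h hh
    refine mem_biUnion.2 ⟨y, ?_, ?_⟩
    · rw [mem_Icc, ← abs_le]
      rw [abs_mul, Nat.abs_cast] at hxQ
      push_cast at hxQ
      exact le_of_mul_le_mul_left hxQ (by exact_mod_cast hm)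
    · push_cast at hx
      obtain ⟨h1, h2⟩ := abs_le.1 hx
      exact mem_Icc.2 ⟨Int.ceil_le.2 (by linarith), Int.le_floor.2 (by linarith)⟩
  have hcard : ∀ y : ℤ, (#(Icc ⌈(m : ℝ) * y - K / 2⌉ ⌊(m : ℝ) * y + K / 2⌋) : ℝ) ≤ 2 * K := by
    intro y
    rw [Int.card_Icc]
    have h1 := Int.floor_le ((m : ℝ) * y + K / 2)
    have h2 := Int.le_ceil ((m : ℝ) * y - K / 2)
    have h3 : (((⌊(m : ℝ) * y + K / 2⌋ + 1 - ⌈(m : ℝ) * y - K / 2⌉).toNat : ℤ) : ℝ) ≤ 2 * K := by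
      rw [Int.toNat_eq_max]
      push_cast
      exact max_le (by linarith) (by linarith)
    exact_mod_cast h3
  have h1 : (#T : ℝ) ≤ ∑ y ∈ Icc (-(d : ℤ)) d, (2 * K) := by
    calc (#T : ℝ) ≤ (#((Icc (-(d : ℤ)) d).biUnion fun y =>
          Icc ⌈(m : ℝ) * y - K / 2⌉ ⌊(m : ℝ) * y + K / 2⌋) : ℝ) := by
          exact_mod_cast card_le_card hsub
      _ ≤ ∑ y ∈ Icc (-(d : ℤ)) d, (#(Icc ⌈(m : ℝ) * y - K / 2⌉ ⌊(m : ℝ) * y + K / 2⌋) : ℝ) := by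
          exact_mod_cast card_biUnion_le
      _ ≤ _ := sum_le_sum fun y _ => hcard y
  rw [sum_const, Int.card_Icc, nsmul_eq_mul] at h1
  have h2 : (((d : ℤ) + 1 - -(d : ℤ)).toNat : ℝ) = 2 * d + 1 := by
    have : ((d : ℤ) + 1 - -(d : ℤ)).toNat = 2 * d + 1 := by omega
    rw [this]
    push_cast
    ring
  rw [h2] at h1
  have h3 : (1 : ℝ) ≤ d := by exact_mod_cast hd
  have h4 : ((m * d : ℕ) : ℝ) / m = d := by
    push_cast
    field_simp
  rw [h4]
  nlinarith

lemma lcm_le_lcm_mul_pow {P D : Finset ℕ} (hD : D ⊆ P) (hP : ∀ q ∈ P, 0 < q) {Y : ℝ}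
    (hY : ∀ q ∈ P, (q : ℝ) ≤ Y) :
    ((P.lcm id : ℕ) : ℝ) / (D.lcm id : ℕ) ≤ Y ^ #(P \ D) := by
  have hDpos : 0 < D.lcm id := by
    refine Nat.pos_of_ne_zero fun h => ?_
    obtain ⟨q, hq, hq0⟩ := lcm_eq_zero_iff.1 h
    exact (hP q (hD hq)).ne' hq0
  have hdvd : P.lcm id ∣ D.lcm id * ∏ q ∈ P \ D, q := by
    refine Finset.lcm_dvd fun q hq => ?_
    by_cases hqD : q ∈ D
    · exact (dvd_lcm (f := id) hqD).mul_right _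
    · exact (dvd_prod_of_mem (fun q => q) (mem_sdiff.2 ⟨hq, hqD⟩)).mul_left _
  have hprod : 0 < ∏ q ∈ P \ D, q := prod_pos fun q hq => hP q (sdiff_subset hq)
  have hle := Nat.le_of_dvd (Nat.mul_pos hDpos hprod) hdvd
  rw [div_le_iff₀ (by exact_mod_cast hDpos)]
  calc ((P.lcm id : ℕ) : ℝ) ≤ ((D.lcm id * ∏ q ∈ P \ D, q : ℕ) : ℝ) := by exact_mod_cast hle
    _ = (∏ q ∈ P \ D, (q : ℝ)) * (D.lcm id : ℕ) := by push_cast; ring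
    _ ≤ Y ^ #(P \ D) * (D.lcm id : ℕ) := by
        gcongr
        rw [← prod_const]
        exact prod_le_prod (fun _ _ => Nat.cast_nonneg _) fun q hq => hY q (sdiff_subset hq)

lemma norm_charFun_le_of_middle {A : Finset ℕ} {p M V H : ℝ} (hp0 : 0 ≤ p) (hp : p ≤ 1 / 2)
    (hpA : p * recipSum A = 1) (hM : 0 < M) (hA : ∀ n ∈ A, M ≤ (n : ℝ))
    (hAV : ∀ n ∈ A, (n : ℝ) ≤ V) (hH : 0 ≤ H) {h : ℤ} (hHh : H ≤ |(h : ℝ)|)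
    (hhM : 2 * |(h : ℝ)| ≤ M) : ‖charFun A p h‖ ≤ Real.exp (-4 * H ^ 2 / V) := by
  refine (norm_charFun_le (δ := fun n => |(h : ℝ)| / n) Subset.rfl hp0 hp
    (fun n _ => by positivity) fun n hn z => ?_).trans (Real.exp_le_exp.2 ?_)
  · have hMn := hA n hn
    have hn0 : (0 : ℝ) < n := hM.trans_le hMn
    have habs : |(h : ℝ) / n| = |(h : ℝ)| / n := by rw [abs_div, abs_of_pos hn0]
    have h1 : |(h : ℝ)| / n ≤ 1 / 2 := by
      rw [div_le_div_iff₀ hn0 two_pos]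
      linarith
    rcases eq_or_ne z 0 with rfl | hz
    · simp [habs]
    · have h2 : (1 : ℝ) ≤ |(z : ℝ)| := by exact_mod_cast Int.one_le_abs hz
      have h3 := abs_sub_abs_le_abs_sub (z : ℝ) ((h : ℝ) / n)
      rw [abs_sub_comm, habs] at h3
      linarith
  · have h1 : H ^ 2 / V * recipSum A ≤ ∑ n ∈ A, (|(h : ℝ)| / n) ^ 2 := by
      rw [recipSum, mul_sum]
      refine sum_le_sum fun n hn => ?_
      have hn0 : (0 : ℝ) < n := hM.trans_le (hA n hn)
      have h2 : H ^ 2 ≤ |(h : ℝ)| ^ 2 := pow_le_pow_left₀ hH hHh 2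
      calc H ^ 2 / V * (1 / (n : ℝ)) ≤ |(h : ℝ)| ^ 2 / n * (1 / (n : ℝ)) := by
            gcongr
            exact hAV n hn
        _ = (|(h : ℝ)| / n) ^ 2 := by field_simp
    have h2 := mul_le_mul_of_nonneg_left h1 hp0
    have h3 : p * (H ^ 2 / V * recipSum A) = H ^ 2 / V := by
      rw [show p * (H ^ 2 / V * recipSum A) = H ^ 2 / V * (p * recipSum A) by ring, hpA, mul_one]
    rw [h3] at h2
    have h4 : -4 * H ^ 2 / V = -4 * (H ^ 2 / V) := by ring
    rw [h4]
    linarith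

lemma recipSum_multiplesIn_sdiff {A B : Finset ℕ} (hB : B ⊆ A) (q : ℕ) :
    recipSum (multiplesIn (A \ B) q) + recipSum (multiplesIn B q) = recipSum (multiplesIn A q) := by
  have h1 : multiplesIn B q ⊆ multiplesIn A q := filter_subset_filter _ hB
  have h2 : multiplesIn (A \ B) q = multiplesIn A q \ multiplesIn B q := by
    ext n
    simp only [mem_multiplesIn, mem_sdiff]
    tauto
  rw [h2]
  exact sum_sdiff h1

/-- Each prime power that is not rich contributes a factor `exp (-b)`. -/
lemma norm_charFun_le_of_poor {A : Finset ℕ} {p V K Y w b : ℝ} (hp0 : 0 ≤ p) (hp : p ≤ 1 / 2)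
    (hpA : p * recipSum A = 1) (hA0 : ∀ n ∈ A, n ≠ 0)
    (hAV : ∀ n ∈ A, (n : ℝ) ≤ V) (hV : 0 < V) (hK : 0 ≤ K) (hY0 : 0 < Y)
    (hY : ∀ q ∈ primePowDivisors A, (q : ℝ) ≤ Y)
    (hρ : ∀ q ∈ primePowDivisors A, 1 / (q : ℝ) ≤ recipSum (multiplesIn A q))
    (hw0 : 0 < w) (hw : ∀ n ∈ A, (#{q ∈ primePowDivisors A | q ∣ n} : ℝ) ≤ w)
    (hb : b * (2 * V * w * Y * recipSum A) ≤ K ^ 2) (h : ℤ) :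
    ‖charFun A p h‖ ≤ Real.exp (-b) ^ #(primePowDivisors A \ richPrimePows A K h) := by
  set P := primePowDivisors A with hP
  set D := richPrimePows A K h with hD
  set B := A \ nearDivisors A K h with hB
  have hBA : B ⊆ A := sdiff_subset
  have hp1 : 0 < p := by
    rcases hp0.lt_or_eq with h1 | h1
    · exact h1
    · rw [← h1, zero_mul] at hpA
      exact absurd hpA zero_ne_one
  have hmass : (#(P \ D) : ℝ) * (1 / (2 * Y)) ≤ w * recipSum B := by
    calc (#(P \ D) : ℝ) * (1 / (2 * Y)) = ∑ q ∈ P \ D, 1 / (2 * Y) := by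
          rw [sum_const, nsmul_eq_mul]
      _ ≤ ∑ q ∈ P \ D, recipSum (multiplesIn B q) := by
          refine sum_le_sum fun q hq => ?_
          obtain ⟨hqP, hqD⟩ := mem_sdiff.1 hq
          have h1 : ¬ recipSum (multiplesIn A q) ≤
              2 * recipSum (multiplesIn (nearDivisors A K h) q) := fun h2 =>
            hqD (mem_richPrimePows.2 ⟨hqP, h2⟩)
          have h2 := recipSum_multiplesIn_sdiff (nearDivisors_subset A K h) q
          rw [← hB] at h2
          have h3 := hρ q hqP
          have hq0 : (0 : ℝ) < q := by exact_mod_cast pos_of_mem_primePowDivisors hqP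
          have h4 : 1 / Y ≤ 1 / (q : ℝ) := one_div_le_one_div_of_le hq0 (hY q hqP)
          have h5 : 1 / (2 * Y) = (1 / Y) / 2 := by field_simp
          rw [h5]
          push Not at h1
          linarith
      _ ≤ ∑ q ∈ P, recipSum (multiplesIn B q) :=
          sum_le_sum_of_subset_of_nonneg sdiff_subset fun q _ _ => recipSum_nonneg _
      _ = ∑ n ∈ B, (#{q ∈ P | q ∣ n} : ℝ) * (1 / (n : ℝ)) := by
          simp only [recipSum, multiplesIn, sum_filter]
          rw [sum_comm]
          refine sum_congr rfl fun n _ => ?_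
          rw [← sum_filter, sum_const, nsmul_eq_mul]
      _ ≤ ∑ n ∈ B, w * (1 / (n : ℝ)) := by
          refine sum_le_sum fun n hn => ?_
          exact mul_le_mul_of_nonneg_right (hw n (hBA hn)) (by positivity)
      _ = w * recipSum B := by rw [recipSum, mul_sum]
  have hnorm : ‖charFun A p h‖ ≤ Real.exp (-4 * p * ∑ n ∈ B, (K / (2 * n)) ^ 2) := by
    refine norm_charFun_le hBA hp0 hp (fun n _ => by positivity) fun n hn z => ?_
    obtain ⟨hnA, hnB⟩ := mem_sdiff.1 hn
    have hn0 : (0 : ℝ) < n := by exact_mod_cast Nat.pos_of_ne_zero (hA0 n hnA)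
    have h1 : K / 2 < |((n * z : ℤ) : ℝ) - h| := by
      by_contra h2
      exact hnB (mem_nearDivisors.2 ⟨hnA, n * z, not_lt.1 h2, dvd_mul_right _ _⟩)
    have h2 : (h : ℝ) / n - z = -(((n * z : ℤ) : ℝ) - h) / n := by
      push_cast
      field_simp
      ring
    rw [h2, abs_div, abs_neg, abs_of_pos hn0, ← div_div]
    exact div_le_div_of_nonneg_right h1.le hn0.le
  refine hnorm.trans ?_
  rw [← Real.exp_nat_mul]
  refine Real.exp_le_exp.2 ?_
  have hsum : K ^ 2 / (4 * V) * recipSum B ≤ ∑ n ∈ B, (K / (2 * n)) ^ 2 := by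
    rw [recipSum, mul_sum]
    refine sum_le_sum fun n hn => ?_
    have hn0 : (0 : ℝ) < n := by exact_mod_cast Nat.pos_of_ne_zero (hA0 n (hBA hn))
    calc K ^ 2 / (4 * V) * (1 / (n : ℝ)) ≤ K ^ 2 / (4 * n) * (1 / (n : ℝ)) := by
          gcongr
          exact hAV n (hBA hn)
      _ = (K / (2 * n)) ^ 2 := by field_simp; norm_num
  have hbp : b ≤ p * (K ^ 2 / (2 * V * w * Y)) := by
    have h1 : b * (2 * V * w * Y) = p * (b * (2 * V * w * Y * recipSum A)) := by
      rw [show p * (b * (2 * V * w * Y * recipSum A)) =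
        b * (2 * V * w * Y) * (p * recipSum A) by ring, hpA, mul_one]
    have h2 : b * (2 * V * w * Y) ≤ p * K ^ 2 := by
      rw [h1]
      exact mul_le_mul_of_nonneg_left hb hp0
    rw [← mul_div_assoc, le_div_iff₀ (by positivity)]
    exact h2
  have hfin : (#(P \ D) : ℝ) * b ≤ 4 * p * ∑ n ∈ B, (K / (2 * n)) ^ 2 := by
    calc (#(P \ D) : ℝ) * b ≤ #(P \ D) * (p * (K ^ 2 / (2 * V * w * Y))) := by gcongr
      _ = p * (K ^ 2 / (V * w)) * (#(P \ D) * (1 / (2 * Y))) := by field_simp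
      _ ≤ p * (K ^ 2 / (V * w)) * (w * recipSum B) := by gcongr
      _ = 4 * p * (K ^ 2 / (4 * V) * recipSum B) := by field_simp
      _ ≤ _ := by gcongr
  linarith

/-- The circle method. If for every `h` a single integer near `h` is divisible by all prime powers
that are rich at `h`, then the frequencies far from `0` contribute little, and some subset of `A`
has reciprocal sum `1`. -/
theorem exists_recipSum_eq_one_of_structure {A : Finset ℕ} {M V K Y H w b : ℝ} (hM : 0 < M)
    (hA : ∀ n ∈ A, M ≤ (n : ℝ)) (hAV : ∀ n ∈ A, (n : ℝ) ≤ V) (hR : 2 ≤ recipSum A)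
    (hY : ∀ q ∈ primePowDivisors A, (q : ℝ) ≤ Y) (hY0 : 0 < Y) (hK : 1 ≤ K) (hKM : 2 * K ≤ M)
    (hstr : ∀ h : ℤ, ∃ x : ℤ, |(x : ℝ) - h| ≤ K / 2 ∧ ∀ q ∈ richPrimePows A K h, (q : ℤ) ∣ x)
    (hρ : ∀ q ∈ primePowDivisors A, 1 / (q : ℝ) ≤ recipSum (multiplesIn A q))
    (hw0 : 0 < w) (hw : ∀ n ∈ A, (#{q ∈ primePowDivisors A | q ∣ n} : ℝ) ≤ w)
    (hH0 : 0 ≤ H) (hHM : 7 * H ≤ M) (hHM3 : 84 * H ^ 3 ≤ M ^ 2)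
    (hmid : 12 * K * Real.exp (-4 * H ^ 2 / V) ≤ 1 / 8)
    (hb : b * (2 * V * w * Y * recipSum A) ≤ K ^ 2)
    (hminor : 6 * K * ((1 + Y * Real.exp (-b)) ^ #(primePowDivisors A) - 1) ≤ 1 / 8)
    (hdev : ((primePowDivisors A).lcm id : ℕ) * (2 * Real.exp (-M / 4)) ≤ 1 / 2) :
    ∃ B ⊆ A, recipSum B = 1 := by
  classical
  by_contra! hno
  set P := primePowDivisors A with hP
  set Q := P.lcm id with hQ
  have hA0 : ∀ n ∈ A, n ≠ 0 := fun n hn => by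
    have := hM.trans_le (hA n hn)
    exact_mod_cast this.ne'
  have hQpos : 0 < Q := lcm_primePowDivisors_pos A
  obtain ⟨n₀, hn₀⟩ : A.Nonempty := by
    rw [nonempty_iff_ne_empty]
    rintro rfl
    simp [recipSum] at hR
    linarith
  have hMQ : M ≤ (Q : ℝ) := (hA n₀ hn₀).trans (by
    exact_mod_cast Nat.le_of_dvd hQpos (dvd_lcm_primePowDivisors hA0 hn₀))
  have hV : 0 < V := hM.trans_le ((hA n₀ hn₀).trans (hAV n₀ hn₀))
  set p : ℝ := 1 / recipSum A with hpdef
  have hRpos : 0 < recipSum A := by linarith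
  have hp0 : 0 ≤ p := by positivity
  have hp : p ≤ 1 / 2 := one_div_le_one_div_of_le two_pos hR
  have hpA : p * recipSum A = 1 := by rw [hpdef]; field_simp
  -- The frequencies `hh i = i - c` run through the residues modulo `Q` of least absolute value.
  set c : ℤ := ((Q / 2 : ℕ) : ℤ) with hc
  set hh : ℕ → ℤ := fun i => (i : ℤ) - c with hhdef
  have hinj : Function.Injective hh := fun i j hij => by
    simp only [hhdef] at hij
    omega
  have hhQ : ∀ i ∈ range Q, 2 * |hh i| ≤ (Q : ℤ) := fun i hi => by
    have := mem_range.1 hi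
    simp only [hhdef, hc]
    rcases abs_cases ((i : ℤ) - ((Q / 2 : ℕ) : ℤ)) with ⟨h1, -⟩ | ⟨h1, -⟩ <;> rw [h1] <;> omega
  have hupper := sum_re_charFun_le hp0 (by linarith) hpA hM hA c
    (fun n hn => dvd_lcm_primePowDivisors hA0 hn) hno
  set F : ℕ → ℂ := fun i => charFun A p (hh i : ℝ) with hF
  -- The frequencies of size at most `K` give at least `1 - 1 / 8`, those above `K` at most `1 / 8`.
  set major := {i ∈ range Q | |(hh i : ℝ)| ≤ K} with hmajor
  set minor := {i ∈ range Q | ¬ |(hh i : ℝ)| ≤ K} with hminor'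
  have hsplit : ∑ i ∈ range Q, (F i).re = ∑ i ∈ major, (F i).re + ∑ i ∈ minor, (F i).re :=
    (sum_filter_add_sum_filter_not _ _ _).symm
  have hi₀ : Q / 2 ∈ major := by
    refine mem_filter.2 ⟨mem_range.2 (by omega), ?_⟩
    have : hh (Q / 2) = 0 := by simp [hhdef, hc]
    rw [this]
    simp
    linarith
  have hF0 : (F (Q / 2)).re = 1 := by
    have : hh (Q / 2) = 0 := by simp [hhdef, hc]
    simp [hF, this, charFun, bernoulliChar, cis_zero]
  have hmajcard : (#major : ℝ) ≤ 12 * K := by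
    have h1 := card_le_of_near_multiples (T := major.image hh) (m := 1) (Q := 1) dvd_rfl one_pos
      (K := 2 * K) (by linarith) (fun h hh' => by
        obtain ⟨i, hi, rfl⟩ := mem_image.1 hh'
        refine ⟨0, ?_, dvd_zero _, by simp⟩
        have := (mem_filter.1 hi).2
        simpa using this)
    rw [card_image_of_injective _ hinj] at h1
    simp only [Nat.cast_one, div_one] at h1
    linarith
  have hmajorsum : 1 - 1 / 8 ≤ ∑ i ∈ major, (F i).re := by
    rw [← add_sum_erase _ _ hi₀, hF0]
    have h1 : ∀ i ∈ major.erase (Q / 2), -Real.exp (-4 * H ^ 2 / V) ≤ (F i).re := by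
      intro i hi
      have hi' := mem_of_mem_erase hi
      have hiK := (mem_filter.1 hi').2
      rcases le_total |(hh i : ℝ)| H with h2 | h2
      · have := re_charFun_nonneg hp0 hp hpA hM hA h2 hHM hHM3
        have h3 := Real.exp_pos (-4 * H ^ 2 / V)
        simp only [hF]
        linarith
      · have := norm_charFun_le_of_middle hp0 hp hpA hM hA hAV hH0 h2 (by linarith)
        have h3 := (abs_le.1 (Complex.abs_re_le_norm (F i))).1
        simp only [hF] at h3 ⊢
        linarith
    have h2 := sum_le_sum h1
    rw [sum_const, nsmul_eq_mul] at h2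
    have h3 : (#(major.erase (Q / 2)) : ℝ) ≤ 12 * K :=
      le_trans (by exact_mod_cast card_le_card (erase_subset _ _)) hmajcard
    have h4 := mul_le_mul_of_nonneg_right h3 (Real.exp_pos (-4 * H ^ 2 / V)).le
    linarith
  have hminorsum : ∑ i ∈ minor, ‖F i‖ ≤ 1 / 8 := by
    set z := Y * Real.exp (-b) with hz
    -- If all prime powers were rich at `h`, then `Q` would divide an integer near `h`; by size that
    -- integer is `0`, and `h` would not be large.
    have hmaps : ∀ i ∈ minor, richPrimePows A K (hh i) ∈ P.powerset.erase P := by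
      intro i hi
      obtain ⟨hiQ, hiK⟩ := mem_filter.1 hi
      refine mem_erase.2 ⟨fun heq => hiK ?_, mem_powerset.2 fun q hq => (mem_richPrimePows.1 hq).1⟩
      obtain ⟨x, hx, hdvd⟩ := hstr (hh i)
      rw [heq] at hdvd
      have hQx : (Q : ℤ) ∣ x := lcm_natCast_dvd hdvd
      have h1 : (|x| : ℝ) < Q := by
        have h2 : (2 * |(hh i : ℝ)| : ℝ) ≤ Q := by exact_mod_cast hhQ i hiQ
        have h3 := abs_sub_abs_le_abs_sub (x : ℝ) (hh i)
        linarith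
      have h2 : x = 0 := Int.eq_zero_of_abs_lt_dvd hQx (by exact_mod_cast h1)
      rw [h2, Int.cast_zero, zero_sub, abs_neg] at hx
      linarith
    rw [← sum_fiberwise_of_maps_to hmaps]
    have hfib : ∀ D ∈ P.powerset.erase P,
        ∑ i ∈ minor with richPrimePows A K (hh i) = D, ‖F i‖ ≤ 6 * K * z ^ #(P \ D) := by
      intro D hD
      have hDP := mem_powerset.1 (mem_of_mem_erase hD)
      set T := {i ∈ minor | richPrimePows A K (hh i) = D} with hT
      have hcard : (#T : ℝ) ≤ 6 * K * ((Q : ℝ) / (D.lcm id : ℕ)) := by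
        rw [← card_image_of_injective T hinj]
        refine card_le_of_near_multiples (lcm_dvd_lcm_of_subset hDP) hQpos hK fun h hh' => ?_
        obtain ⟨i, hi, rfl⟩ := mem_image.1 hh'
        obtain ⟨hi1, hi2⟩ := mem_filter.1 hi
        obtain ⟨x, hx, hdvd⟩ := hstr (hh i)
        rw [hi2] at hdvd
        refine ⟨x, hx, lcm_natCast_dvd hdvd, ?_⟩
        have h1 : (|x| : ℝ) ≤ Q := by
          have h2 : (2 * |(hh i : ℝ)| : ℝ) ≤ Q := by exact_mod_cast hhQ i (mem_filter.1 hi1).1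
          have h3 := abs_sub_abs_le_abs_sub (x : ℝ) (hh i)
          linarith
        exact_mod_cast h1
      have hterm : ∀ i ∈ T, ‖F i‖ ≤ Real.exp (-b) ^ #(P \ D) := fun i hi => by
        have := norm_charFun_le_of_poor hp0 hp hpA hA0 hAV hV (by linarith) hY0 hY hρ hw0 hw hb
          (hh i)
        rwa [(mem_filter.1 hi).2] at this
      have hexp : 0 ≤ Real.exp (-b) ^ #(P \ D) := by positivity
      calc ∑ i ∈ T, ‖F i‖ ≤ ∑ i ∈ T, Real.exp (-b) ^ #(P \ D) := sum_le_sum hterm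
        _ = #T * Real.exp (-b) ^ #(P \ D) := by rw [sum_const, nsmul_eq_mul]
        _ ≤ 6 * K * Y ^ #(P \ D) * Real.exp (-b) ^ #(P \ D) := by
            refine mul_le_mul_of_nonneg_right (hcard.trans ?_) hexp
            refine mul_le_mul_of_nonneg_left ?_ (by linarith)
            exact lcm_le_lcm_mul_pow hDP (fun q hq => pos_of_mem_primePowDivisors hq) hY
        _ = 6 * K * z ^ #(P \ D) := by rw [hz, mul_pow]; ring
    refine (sum_le_sum hfib).trans ?_
    rw [← mul_sum]
    have hbin : ∑ D ∈ P.powerset.erase P, z ^ #(P \ D) = (1 + z) ^ #P - 1 := by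
      have h1 : (1 + z) ^ #P = ∑ D ∈ P.powerset, z ^ #(P \ D) := by
        have := prod_add (fun _ => (1 : ℝ)) (fun _ => z) P
        simpa using this
      rw [h1, ← add_sum_erase _ _ (mem_powerset_self P)]
      simp
    rw [hbin]
    exact hminor
  have hminorre : -(1 / 8) ≤ ∑ i ∈ minor, (F i).re := by
    have h1 : ∀ i ∈ minor, -‖F i‖ ≤ (F i).re := fun i _ =>
      (abs_le.1 (Complex.abs_re_le_norm (F i))).1
    have h2 := sum_le_sum h1
    rw [sum_neg_distrib] at h2
    linarith
  have hup : ∑ i ∈ range Q, (F i).re ≤ 1 / 2 := hupper.trans hdev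
  linarith

/-! ### Rich prime powers divide a common integer -/

/-- `n` is `y`-smooth: its prime factors are at most `y`. -/
def Smooth (y n : ℕ) : Prop := ∀ p : ℕ, p.Prime → p ∣ n → p ≤ y

/-- `n` is `y`-rough: its prime factors are greater than `y`. -/
def Rough (y n : ℕ) : Prop := ∀ p : ℕ, p.Prime → p ∣ n → y < p

lemma exists_rough_mul_smooth (y : ℕ) {n : ℕ} (hn : n ≠ 0) :
    ∃ u m : ℕ, n = u * m ∧ Rough y u ∧ Smooth y m := by
  induction n using induction_on_primes with
  | zero => exact absurd rfl hn
  | one =>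
    exact ⟨1, 1, rfl, fun p hp h => absurd (Nat.dvd_one.1 h) hp.ne_one,
      fun p hp h => absurd (Nat.dvd_one.1 h) hp.ne_one⟩
  | prime_mul p a hp ih =>
    obtain ⟨u, m, rfl, hu, hm⟩ := ih (right_ne_zero_of_mul hn)
    have hpr := Nat.prime_iff.2 hp.prime
    rcases le_or_gt p y with h | h
    · refine ⟨u, p * m, by ring, hu, fun r hr hrd => ?_⟩
      rcases hr.dvd_mul.1 hrd with h1 | h1
      · rwa [(Nat.prime_dvd_prime_iff_eq hr hpr).1 h1]
      · exact hm r hr h1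
    · refine ⟨p * u, m, by ring, fun r hr hrd => ?_, hm⟩
      rcases hr.dvd_mul.1 hrd with h1 | h1
      · rwa [(Nat.prime_dvd_prime_iff_eq hr hpr).1 h1]
      · exact hu r hr h1

/-- A rich prime power divides an integer in the interval that has many small prime factors. The
elements `q * u * m` with the same rough part `u` all divide the only multiple of `q * u` in the
interval. -/
lemma exists_multiple_of_rich {A : Finset ℕ} {N y : ℕ} {M K W ρ U : ℝ} (hM : 0 < M)
    (hA : ∀ n ∈ A, M ≤ (n : ℝ)) (hAN : ∀ n ∈ A, n ≤ N)
    (hsm : ∀ n ∈ A, ∀ m, m ∣ n → Smooth y m → (m : ℝ) ≤ W) (hKW : K * W < M) (hρ0 : 0 < ρ)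
    (hρ : ∀ q ∈ primePowDivisors A, ρ / (q : ℝ) ≤ recipSum (multiplesIn A q)) (hU0 : 0 < U)
    (hU : ∀ T : Finset ℕ, (∀ u ∈ T, u ≠ 0 ∧ u ≤ N ∧ Rough y u) → recipSum T ≤ U)
    {h : ℤ} {q : ℕ} (hq : q ∈ richPrimePows A K h) :
    ∃ x : ℤ, |(x : ℝ) - h| ≤ K / 2 ∧ (q : ℤ) ∣ x ∧
      ρ / (2 * U) ≤ eulerProd {p ∈ Nat.primesLE y | (p : ℤ) ∣ x} := by
  classical
  obtain ⟨hqP, hqrich⟩ := mem_richPrimePows.1 hq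
  have hq0 : 0 < q := pos_of_mem_primePowDivisors hqP
  have hqR : (0 : ℝ) < q := by exact_mod_cast hq0
  set B := multiplesIn (nearDivisors A K h) q with hB
  have hBA : ∀ n ∈ B, n ∈ A := fun n hn => nearDivisors_subset _ _ _ (mem_multiplesIn.1 hn).1
  have hn0 : ∀ n ∈ A, n ≠ 0 := fun n hn => by
    have := hM.trans_le (hA n hn)
    exact_mod_cast this.ne'
  have hex : ∀ n : ℕ, ∃ u m : ℕ, n ∈ B → n = q * u * m ∧ Rough y u ∧ Smooth y m := by
    intro n
    by_cases hn : n ∈ B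
    · obtain ⟨k, hk⟩ := (mem_multiplesIn.1 hn).2
      have hk0 : k ≠ 0 := fun h0 => hn0 n (hBA n hn) (by rw [hk, h0, mul_zero])
      obtain ⟨u, m, hum, hu, hm⟩ := exists_rough_mul_smooth y hk0
      exact ⟨u, m, fun _ => ⟨by rw [hk, hum, mul_assoc], hu, hm⟩⟩
    · exact ⟨0, 0, fun h => absurd h hn⟩
  choose u m hum using hex
  have hpos : ∀ n ∈ B, 0 < u n ∧ 0 < m n := fun n hn => by
    have h1 := hn0 n (hBA n hn)
    rw [(hum n hn).1] at h1
    exact ⟨Nat.pos_of_ne_zero (right_ne_zero_of_mul (left_ne_zero_of_mul h1)),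
      Nat.pos_of_ne_zero (right_ne_zero_of_mul h1)⟩
  have hxs : ∀ n : ℕ, ∃ x : ℤ, n ∈ B → |(x : ℝ) - h| ≤ K / 2 ∧ (n : ℤ) ∣ x := fun n => by
    by_cases hn : n ∈ B
    · obtain ⟨x, hx⟩ := (mem_nearDivisors.1 (mem_multiplesIn.1 hn).1).2
      exact ⟨x, fun _ => hx⟩
    · exact ⟨0, fun h => absurd h hn⟩
  choose x hx using hxs
  have hmass : ρ / 2 ≤ ∑ v ∈ B.image u, (1 / (v : ℝ)) * ∑ n ∈ B with u n = v, 1 / (m n : ℝ) := by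
    have h1 : ρ / q ≤ 2 * recipSum B := (hρ q hqP).trans hqrich
    have h2 : ∑ v ∈ B.image u, (1 / (v : ℝ)) * ∑ n ∈ B with u n = v, 1 / (m n : ℝ) =
        q * recipSum B := by
      rw [recipSum, mul_sum, ← sum_fiberwise_of_maps_to (g := u) (t := B.image u)
        (fun n hn => mem_image_of_mem u hn)]
      refine sum_congr rfl fun v _ => ?_
      rw [mul_sum]
      refine sum_congr rfl fun n hn => ?_
      obtain ⟨hnB, rfl⟩ := mem_filter.1 hn
      have h3 : (n : ℝ) = q * u n * m n := by exact_mod_cast (hum n hnB).1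
      obtain ⟨hu0, hm0⟩ := hpos n hnB
      have hu0' : (0 : ℝ) < u n := by exact_mod_cast hu0
      have hm0' : (0 : ℝ) < m n := by exact_mod_cast hm0
      rw [h3]
      field_simp
    rw [h2]
    rw [div_le_iff₀ hqR] at h1
    linarith
  obtain ⟨v, hv, hvmass⟩ : ∃ v ∈ B.image u,
      ρ / (2 * U) ≤ ∑ n ∈ B with u n = v, 1 / (m n : ℝ) := by
    by_contra! hcon
    have hne : (B.image u).Nonempty := by
      rw [nonempty_iff_ne_empty]
      intro h0
      rw [h0, sum_empty] at hmass
      linarith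
    have hvpos : ∀ v ∈ B.image u, (0 : ℝ) < 1 / (v : ℝ) := fun v hv => by
      obtain ⟨n, hn, rfl⟩ := mem_image.1 hv
      have : (0 : ℝ) < u n := by exact_mod_cast (hpos n hn).1
      positivity
    have h1 := sum_lt_sum_of_nonempty hne fun v hv =>
      mul_lt_mul_of_pos_left (hcon v hv) (hvpos v hv)
    rw [← sum_mul] at h1
    have h2 : ∑ v ∈ B.image u, 1 / (v : ℝ) ≤ U := hU _ fun v hv => by
      obtain ⟨n, hn, rfl⟩ := mem_image.1 hv
      refine ⟨(hpos n hn).1.ne', le_trans (Nat.le_of_dvd (Nat.pos_of_ne_zero (hn0 n (hBA n hn))) ?_)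
        (hAN n (hBA n hn)), (hum n hn).2.1⟩
      exact ⟨q * m n, by rw [mul_left_comm, ← mul_assoc]; exact (hum n hn).1⟩
    have h3 : (∑ v ∈ B.image u, 1 / (v : ℝ)) * (ρ / (2 * U)) ≤ U * (ρ / (2 * U)) :=
      mul_le_mul_of_nonneg_right h2 (by positivity)
    have h4 : U * (ρ / (2 * U)) = ρ / 2 := by field_simp
    linarith
  obtain ⟨n₀, hn₀, hun₀⟩ := mem_image.1 hv
  set F := {n ∈ B | u n = v} with hF
  -- The elements are at least `M` and their smooth parts at most `W`, so `q * v` exceeds `K`, and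
  -- the interval contains at most one multiple of it.
  have hbig : K < (q * v : ℕ) := by
    have h1 : (n₀ : ℝ) = (q * v : ℕ) * m n₀ := by
      have := (hum n₀ hn₀).1
      rw [hun₀] at this
      exact_mod_cast this
    have h2 : (m n₀ : ℝ) ≤ W := hsm n₀ (hBA n₀ hn₀) (m n₀)
      ⟨q * u n₀, by rw [mul_comm]; exact (hum n₀ hn₀).1⟩ (hum n₀ hn₀).2.2
    have h3 := hA n₀ (hBA n₀ hn₀)
    have h4 : (1 : ℝ) ≤ m n₀ := by exact_mod_cast (hpos n₀ hn₀).2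
    by_contra! h5
    have h6 : (0 : ℝ) ≤ (q * v : ℕ) := Nat.cast_nonneg _
    have h7 : (n₀ : ℝ) ≤ K * W := by
      rw [h1]
      exact mul_le_mul h5 h2 (by linarith) (h6.trans h5)
    linarith
  have hxeq : ∀ n ∈ F, x n = x n₀ := by
    intro n hn
    obtain ⟨hnB, hun⟩ := mem_filter.1 hn
    have hd : ∀ k ∈ B, u k = v → ((q * v : ℕ) : ℤ) ∣ x k := fun k hk hku => by
      refine dvd_trans (Int.natCast_dvd_natCast.2 ⟨m k, ?_⟩) (hx k hk).2
      rw [← hku]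
      exact (hum k hk).1
    have hdvd := dvd_sub (hd n hnB hun) (hd n₀ hn₀ hun₀)
    have h1 : |((x n - x n₀ : ℤ) : ℝ)| ≤ K := by
      push_cast
      have h2 := (hx n hnB).1
      have h3 := (hx n₀ hn₀).1
      rw [abs_sub_comm] at h3
      have h4 := abs_sub_le (x n : ℝ) h (x n₀)
      linarith
    have h2 : |x n - x n₀| < ((q * v : ℕ) : ℤ) := by
      have := h1.trans_lt hbig
      exact_mod_cast this
    exact sub_eq_zero.1 (Int.eq_zero_of_abs_lt_dvd hdvd h2)
  refine ⟨x n₀, (hx n₀ hn₀).1, dvd_trans (Int.natCast_dvd_natCast.2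
    (mem_multiplesIn.1 hn₀).2) (hx n₀ hn₀).2, hvmass.trans ?_⟩
  have hinj : Set.InjOn m F := by
    intro a ha b hb hab
    obtain ⟨ha1, ha2⟩ := mem_filter.1 (mem_coe.1 ha)
    obtain ⟨hb1, hb2⟩ := mem_filter.1 (mem_coe.1 hb)
    rw [(hum a ha1).1, (hum b hb1).1, ha2, hb2, hab]
  have hsum : ∑ n ∈ F, 1 / (m n : ℝ) = recipSum (F.image m) := by
    rw [recipSum, sum_image hinj]
  rw [hsum]
  refine sum_inv_le_eulerProd (fun p hp => Nat.prime_of_mem_primesLE (mem_filter.1 hp).1) ?_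
  intro k hk
  obtain ⟨n, hn, rfl⟩ := mem_image.1 hk
  have hnB := (mem_filter.1 hn).1
  refine ⟨(hpos n hnB).2.ne', fun p hp hpm => mem_filter.2
    ⟨Nat.mem_primesLE.2 ⟨(hum n hnB).2.2 p hp hpm, hp⟩, ?_⟩⟩
  rw [← hxeq n hn]
  refine dvd_trans (Int.natCast_dvd_natCast.2 (hpm.trans ?_)) (hx n hnB).2
  exact ⟨q * u n, by rw [mul_comm]; exact (hum n hnB).1⟩

lemma exists_common_multiple_of_rich {A : Finset ℕ} {N y : ℕ} {M K W ρ U : ℝ} (hM : 0 < M)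
    (hA : ∀ n ∈ A, M ≤ (n : ℝ)) (hAN : ∀ n ∈ A, n ≤ N)
    (hsm : ∀ n ∈ A, ∀ m, m ∣ n → Smooth y m → (m : ℝ) ≤ W) (hK : 0 ≤ K) (hKW : K * W < M)
    (hρ0 : 0 < ρ)
    (hρ : ∀ q ∈ primePowDivisors A, ρ / (q : ℝ) ≤ recipSum (multiplesIn A q)) (hU0 : 0 < U)
    (hU : ∀ T : Finset ℕ, (∀ u ∈ T, u ≠ 0 ∧ u ≤ N ∧ Rough y u) → recipSum T ≤ U)
    (hcommon : ∀ P₁ P₂ : Finset ℕ, P₁ ⊆ Nat.primesLE y → P₂ ⊆ Nat.primesLE y →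
      ρ / (2 * U) ≤ eulerProd P₁ → ρ / (2 * U) ≤ eulerProd P₂ →
      K < ((∏ p ∈ P₁ ∩ P₂, p : ℕ) : ℝ)) (h : ℤ) :
    ∃ x : ℤ, |(x : ℝ) - h| ≤ K / 2 ∧ ∀ q ∈ richPrimePows A K h, (q : ℤ) ∣ x := by
  have key := fun q (hq : q ∈ richPrimePows A K h) =>
    exists_multiple_of_rich hM hA hAN hsm hKW hρ0 hρ hU0 hU hq
  rcases (richPrimePows A K h).eq_empty_or_nonempty with he | ⟨q₀, hq₀⟩
  · refine ⟨h, by simp; linarith, ?_⟩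
    rw [he]
    simp
  · obtain ⟨x₀, hx₀, -, hE₀⟩ := key q₀ hq₀
    refine ⟨x₀, hx₀, fun q hq => ?_⟩
    obtain ⟨x, hx, hqx, hE⟩ := key q hq
    have hlt := hcommon _ _ (filter_subset _ _) (filter_subset _ _) hE hE₀
    set P : Finset ℕ := ({p ∈ Nat.primesLE y | ((p : ℕ) : ℤ) ∣ x} : Finset ℕ) ∩
      ({p ∈ Nat.primesLE y | ((p : ℕ) : ℤ) ∣ x₀} : Finset ℕ) with hP
    have hdvd : ((∏ p ∈ P, p : ℕ) : ℤ) ∣ x - x₀ := by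
      rw [Int.natCast_dvd]
      refine Finset.prod_primes_dvd _ (fun p hp => ?_) fun p hp => ?_
      · exact (Nat.prime_of_mem_primesLE (mem_filter.1 (mem_inter.1 hp).1).1).prime
      · exact Int.natCast_dvd.1 (dvd_sub (mem_filter.1 (mem_inter.1 hp).1).2
          (mem_filter.1 (mem_inter.1 hp).2).2)
    have h1 : |((x - x₀ : ℤ) : ℝ)| ≤ K := by
      push_cast
      rw [abs_sub_comm] at hx₀
      have h4 := abs_sub_le (x : ℝ) h x₀
      linarith
    have h2 : |x - x₀| < ((∏ p ∈ P, p : ℕ) : ℤ) := by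
      have := h1.trans_lt hlt
      exact_mod_cast this
    rwa [← sub_eq_zero.1 (Int.eq_zero_of_abs_lt_dvd hdvd h2)]

/-! ### Sums of reciprocals over special sets -/

lemma recipSum_le_mul {T S₁ S₂ : Finset ℕ} (h : ∀ n ∈ T, ∃ a ∈ S₁, ∃ b ∈ S₂, n = a * b) :
    recipSum T ≤ recipSum S₁ * recipSum S₂ := by
  have hex : ∀ n : ℕ, ∃ c : ℕ × ℕ, n ∈ T → c ∈ S₁ ×ˢ S₂ ∧ n = c.1 * c.2 := fun n => by
    by_cases hn : n ∈ T
    · obtain ⟨a, ha, b, hb, hab⟩ := h n hn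
      exact ⟨(a, b), fun _ => ⟨mem_product.2 ⟨ha, hb⟩, hab⟩⟩
    · exact ⟨(0, 0), fun h => absurd h hn⟩
  choose c hc using hex
  have hinj : Set.InjOn c T := fun a ha b hb hab => by
    rw [(hc a ha).2, (hc b hb).2, hab]
  calc recipSum T = ∑ n ∈ T, 1 / ((c n).1 : ℝ) * (1 / ((c n).2 : ℝ)) := by
        refine sum_congr rfl fun n hn => ?_
        conv_lhs => rw [(hc n hn).2]
        push_cast
        rw [one_div_mul_one_div]
    _ = ∑ d ∈ T.image c, 1 / (d.1 : ℝ) * (1 / (d.2 : ℝ)) := by rw [sum_image hinj]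
    _ ≤ ∑ d ∈ S₁ ×ˢ S₂, 1 / (d.1 : ℝ) * (1 / (d.2 : ℝ)) := by
        refine sum_le_sum_of_subset_of_nonneg (fun d hd => ?_) fun d _ _ => by positivity
        obtain ⟨n, hn, rfl⟩ := mem_image.1 hd
        exact (hc n hn).1
    _ = recipSum S₁ * recipSum S₂ := by rw [sum_product, recipSum, recipSum, sum_mul_sum]

lemma recipSum_rough_le {y N : ℕ} (hy : 2 ≤ y) (hyN : y ≤ N) {T : Finset ℕ}
    (hT : ∀ u ∈ T, u ≠ 0 ∧ u ≤ N ∧ Rough y u) :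
    recipSum T ≤ 1300 * Real.log N / Real.log y := by
  have hsub : Nat.primesLE y ⊆ Nat.primesLE N := fun p hp =>
    Nat.mem_primesLE.2 ⟨(Nat.le_of_mem_primesLE hp).trans hyN, Nat.prime_of_mem_primesLE hp⟩
  have h1 : recipSum T ≤ eulerProd (Nat.primesLE N \ Nat.primesLE y) := by
    refine sum_inv_le_eulerProd (fun p hp => Nat.prime_of_mem_primesLE (sdiff_subset hp)) ?_
    intro u hu
    obtain ⟨hu0, huN, hur⟩ := hT u hu
    refine ⟨hu0, fun p hp hpu => mem_sdiff.2 ⟨Nat.mem_primesLE.2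
      ⟨(Nat.le_of_dvd (Nat.pos_of_ne_zero hu0) hpu).trans huN, hp⟩, fun hpy => ?_⟩⟩
    exact absurd (Nat.le_of_mem_primesLE hpy) (not_le.2 (hur p hp hpu))
  have h2 : eulerProd (Nat.primesLE N \ Nat.primesLE y) * eulerProd (Nat.primesLE y) =
      eulerProd (Nat.primesLE N) := prod_sdiff hsub
  have hlog : 0 < Real.log y := Real.log_pos (by exact_mod_cast hy)
  rw [le_div_iff₀ hlog]
  calc recipSum T * Real.log y
      ≤ eulerProd (Nat.primesLE N \ Nat.primesLE y) * eulerProd (Nat.primesLE y) :=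
        mul_le_mul h1 (log_le_eulerProd_primesLE y) hlog.le
          (eulerProd_pos fun p hp => Nat.prime_of_mem_primesLE (sdiff_subset hp)).le
    _ ≤ 1300 * Real.log N := by
        rw [h2]
        exact eulerProd_primesLE_le (hy.trans hyN)

lemma eulerProd_le_of_card_le {P : Finset ℕ} (hP : ∀ p ∈ P, p.Prime) {r : ℕ} (hr : 2 ≤ r)
    (hcard : #P ≤ r) : eulerProd P ≤ 3900 * Real.log r := by
  have hr0 : (0 : ℝ) < r := by positivity
  have hsplit : eulerProd P = eulerProd {p ∈ P | p ≤ r} * eulerProd {p ∈ P | ¬ p ≤ r} :=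
    (prod_filter_mul_prod_filter_not _ _ _).symm
  have h1 : eulerProd {p ∈ P | p ≤ r} ≤ 1300 * Real.log r := by
    refine (eulerProd_mono (fun p hp => ?_) (primes_of_primesLE r)).trans (eulerProd_primesLE_le hr)
    obtain ⟨hp1, hp2⟩ := mem_filter.1 hp
    exact Nat.mem_primesLE.2 ⟨hp2, hP p hp1⟩
  have h2 : eulerProd {p ∈ P | ¬ p ≤ r} ≤ 3 := by
    have h3 : ∀ p ∈ {p ∈ P | ¬ p ≤ r}, (1 - 1 / (p : ℝ))⁻¹ ≤ Real.exp (1 / r) := by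
      intro p hp
      have hp2 : (r : ℝ) + 1 ≤ p := by exact_mod_cast not_le.1 (mem_filter.1 hp).2
      have hp0 : (0 : ℝ) < p := by linarith
      have h4 : (1 - 1 / (p : ℝ))⁻¹ = p / (p - 1) := by
        have : (p : ℝ) - 1 ≠ 0 := by linarith
        field_simp
      rw [h4, div_le_iff₀ (by linarith)]
      have h5 := Real.add_one_le_exp (1 / (r : ℝ))
      have h6 : (p : ℝ) ≤ (1 / r + 1) * (p - 1) := by
        have h7 : (1 : ℝ) ≤ 1 / r * (p - 1) := by
          rw [one_div_mul_eq_div, le_div_iff₀ hr0]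
          linarith
        linarith
      exact h6.trans (mul_le_mul_of_nonneg_right h5 (by linarith))
    calc eulerProd {p ∈ P | ¬ p ≤ r} ≤ ∏ p ∈ {p ∈ P | ¬ p ≤ r}, Real.exp (1 / r) :=
          prod_le_prod (fun p hp => zero_le_one.trans
            (one_le_inv_factor (hP p (mem_filter.1 hp).1))) h3
      _ = Real.exp (#{p ∈ P | ¬ p ≤ r} * (1 / r)) := by rw [prod_const, ← Real.exp_nat_mul]
      _ ≤ Real.exp 1 := by
          refine Real.exp_le_exp.2 ?_
          rw [mul_one_div, div_le_one hr0]
          exact_mod_cast (card_le_card (filter_subset _ _)).trans hcard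
      _ ≤ 3 := by linarith [Real.exp_one_lt_d9]
  rw [hsplit]
  have h3 : 0 ≤ eulerProd {p ∈ P | ¬ p ≤ r} :=
    (eulerProd_pos fun p hp => hP p (mem_filter.1 hp).1).le
  have hlog : 0 ≤ Real.log r := Real.log_natCast_nonneg r
  calc _ ≤ (1300 * Real.log r) * 3 := mul_le_mul h1 h2 h3 (by positivity)
    _ = _ := by ring

/-- If two sets of primes up to `y` share at most `r` primes, then the product of their Euler
products exceeds the full one by a factor `O(log r)` at most, since a set of `r` primes has Euler
product `O(log r)`. Otherwise the product of the shared primes exceeds `2 ^ r`. -/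
lemma lt_prod_inter {y r : ℕ} (hy : 2 ≤ y) (hr : 2 ≤ r) {τ K : ℝ} (hτ : 0 ≤ τ)
    (hτy : 1300 * Real.log y * (3900 * Real.log r) < τ ^ 2) (hK : K < 2 ^ r) {P₁ P₂ : Finset ℕ}
    (h₁ : P₁ ⊆ Nat.primesLE y) (h₂ : P₂ ⊆ Nat.primesLE y) (hτ₁ : τ ≤ eulerProd P₁)
    (hτ₂ : τ ≤ eulerProd P₂) : K < ((∏ p ∈ P₁ ∩ P₂, p : ℕ) : ℝ) := by
  have hprime : ∀ p ∈ P₁ ∩ P₂, p.Prime := fun p hp =>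
    Nat.prime_of_mem_primesLE (h₁ (mem_inter.1 hp).1)
  have hcard : r < #(P₁ ∩ P₂) := by
    by_contra! hle
    have h3 := eulerProd_le_of_card_le hprime hr hle
    have h4 : eulerProd (P₁ ∪ P₂) * eulerProd (P₁ ∩ P₂) = eulerProd P₁ * eulerProd P₂ :=
      prod_union_inter
    have h5 : eulerProd (P₁ ∪ P₂) ≤ 1300 * Real.log y :=
      (eulerProd_mono (union_subset h₁ h₂) (primes_of_primesLE y)).trans (eulerProd_primesLE_le hy)
    have h6 : τ ^ 2 ≤ eulerProd P₁ * eulerProd P₂ := by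
      rw [sq]
      exact mul_le_mul hτ₁ hτ₂ hτ (hτ.trans hτ₁)
    have hlog : 0 ≤ Real.log y := Real.log_natCast_nonneg y
    have h7 : eulerProd (P₁ ∪ P₂) * eulerProd (P₁ ∩ P₂) ≤
        1300 * Real.log y * (3900 * Real.log r) :=
      mul_le_mul h5 h3 (eulerProd_pos hprime).le (by positivity)
    linarith
  have h8 : 2 ^ #(P₁ ∩ P₂) ≤ ∏ p ∈ P₁ ∩ P₂, p := by
    rw [← prod_const]
    exact prod_le_prod' fun p hp => (hprime p hp).two_le
  have h9 : 2 ^ r ≤ ∏ p ∈ P₁ ∩ P₂, p := (Nat.pow_le_pow_right two_pos hcard.le).trans h8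
  exact hK.trans_le (by exact_mod_cast h9)

/-- The sum of `1 / q` over prime powers `q ≤ N` is at most twice the logarithm of the Euler
product. -/
lemma recipSum_primePow_le {N : ℕ} (hN : 2 ≤ N) {T : Finset ℕ}
    (hT : ∀ q ∈ T, IsPrimePow q ∧ q ≤ N) : recipSum T ≤ 2 * Real.log (1300 * Real.log N) := by
  have hmaps : ∀ q ∈ T, q.minFac ∈ Nat.primesLE N := fun q hq =>
    Nat.mem_primesLE.2 ⟨(Nat.minFac_le (hT q hq).1.pos).trans (hT q hq).2,
      Nat.minFac_prime (hT q hq).1.ne_one⟩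
  have hfib : ∀ p ∈ Nat.primesLE N,
      ∑ q ∈ T with q.minFac = p, 1 / (q : ℝ) ≤ 2 * Real.log (1 - 1 / (p : ℝ))⁻¹ := by
    intro p hp
    have hpp := Nat.prime_of_mem_primesLE hp
    have hp2 : (2 : ℝ) ≤ p := by exact_mod_cast hpp.two_le
    set F := {q ∈ T | q.minFac = p} with hF
    have h1F : 1 ∉ F := fun h => (hT 1 (mem_filter.1 h).1).1.ne_one rfl
    -- The powers of `p`, including the trivial one, are summed by the Euler factor at `p`.
    have h1 : recipSum (insert 1 F) ≤ eulerProd {p} := by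
      refine sum_inv_le_eulerProd (by simpa using hpp) fun q hq => ?_
      rcases mem_insert.1 hq with rfl | hq
      · exact ⟨one_ne_zero, fun r hr h => absurd (Nat.dvd_one.1 h) hr.ne_one⟩
      · obtain ⟨hqT, hqp⟩ := mem_filter.1 hq
        have hpow := (hT q hqT).1
        refine ⟨hpow.ne_zero, fun r hr hrq => mem_singleton.2 ?_⟩
        obtain ⟨s, k, hs, hk, rfl⟩ := hpow
        rw [← hqp, hs.nat_prime.pow_minFac hk.ne']
        exact (Nat.prime_dvd_prime_iff_eq hr hs.nat_prime).1 (hr.dvd_of_dvd_pow hrq)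
    rw [recipSum, sum_insert h1F, eulerProd, prod_singleton] at h1
    set t : ℝ := 1 / (p : ℝ) with ht
    have ht2 : t ≤ 1 / 2 := one_div_le_one_div_of_le two_pos hp2
    have ht0 : 0 < t := by positivity
    have h2 : (1 - t)⁻¹ ≤ 1 + 2 * t := by
      rw [inv_le_iff_one_le_mul₀ (by linarith)]
      nlinarith
    have h3 : t ≤ Real.log (1 - t)⁻¹ := by
      rw [Real.log_inv]
      have := Real.log_le_sub_one_of_pos (show 0 < 1 - t by linarith)
      linarith
    push_cast at h1
    linarith
  calc recipSum T = ∑ p ∈ Nat.primesLE N, ∑ q ∈ T with q.minFac = p, 1 / (q : ℝ) :=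
        (sum_fiberwise_of_maps_to hmaps _).symm
    _ ≤ ∑ p ∈ Nat.primesLE N, 2 * Real.log (1 - 1 / (p : ℝ))⁻¹ := sum_le_sum hfib
    _ = 2 * Real.log (eulerProd (Nat.primesLE N)) := by
        rw [← mul_sum, eulerProd, Real.log_prod fun p hp =>
          (one_pos.trans_le (one_le_inv_factor (Nat.prime_of_mem_primesLE hp))).ne']
    _ ≤ _ := by
        have := Real.log_le_log (eulerProd_pos (primes_of_primesLE N)) (eulerProd_primesLE_le hN)
        linarith

/-- Rankin's bound for the integers that have a large smooth divisor. -/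
lemma recipSum_large_smooth_le {y N : ℕ} {W : ℝ} (hW : 0 < W) (hy : 8 ≤ y) {T : Finset ℕ}
    (hT : ∀ n ∈ T, n ≠ 0 ∧ n ≤ N ∧ ∃ m, m ∣ n ∧ Smooth y m ∧ W < (m : ℝ)) :
    recipSum T ≤ (1300 * Real.log y) ^ 11 * Real.exp (-(Real.log W / Real.log y)) *
      (1 + Real.log N) := by
  classical
  set S := {m ∈ Icc 1 N | Smooth y m ∧ W < (m : ℝ)} with hS
  have h1 : recipSum T ≤ recipSum S * recipSum (Icc 1 N) := by
    refine recipSum_le_mul fun n hn => ?_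
    obtain ⟨hn0, hnN, m, ⟨k, rfl⟩, hms, hmW⟩ := hT n hn
    have hm0 : 0 < m := Nat.pos_of_ne_zero (left_ne_zero_of_mul hn0)
    have hk0 : 0 < k := Nat.pos_of_ne_zero (right_ne_zero_of_mul hn0)
    exact ⟨m, mem_filter.2 ⟨mem_Icc.2 ⟨hm0, (Nat.le_mul_of_pos_right m hk0).trans hnN⟩, hms, hmW⟩,
      k, mem_Icc.2 ⟨hk0, (Nat.le_mul_of_pos_left k hm0).trans hnN⟩, rfl⟩
  have hlog8 : 2 ≤ Real.log y := by
    have h2 : Real.log 8 ≤ Real.log y := Real.log_le_log (by norm_num) (by exact_mod_cast hy)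
    have h3 : Real.log 8 = 3 * Real.log 2 := by
      rw [show (8 : ℝ) = 2 ^ 3 by norm_num, Real.log_pow]; norm_num
    linarith [Real.log_two_gt_d9]
  set η : ℝ := 1 / Real.log y with hη
  have hη0 : 0 < η := by positivity
  have hη2 : η ≤ 1 / 2 := one_div_le_one_div_of_le two_pos hlog8
  have h2 : recipSum S ≤ Real.exp (-(Real.log W / Real.log y)) * ∑ m ∈ S, rpowNeg (1 - η) m := by
    rw [recipSum, mul_sum]
    refine sum_le_sum fun m hm => ?_
    obtain ⟨hm1, -, hmW⟩ := mem_filter.1 hm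
    have hm0 : (0 : ℝ) < m := by exact_mod_cast (mem_Icc.1 hm1).1
    rw [rpowNeg_apply, show -(1 - η) = -1 + η by ring, Real.rpow_add hm0, Real.rpow_neg_one,
      Real.rpow_def_of_pos hm0, ← one_div, mul_comm, mul_assoc, ← Real.exp_add]
    refine le_mul_of_one_le_right (by positivity) (Real.one_le_exp ?_)
    have h3 : Real.log W ≤ Real.log m := Real.log_le_log hW hmW.le
    have h4 : Real.log W / Real.log y = Real.log W * η := by rw [hη]; ring
    rw [h4]
    nlinarith
  have h3 : ∑ m ∈ S, rpowNeg (1 - η) m ≤ ∏ p ∈ Nat.primesLE y, (1 - rpowNeg (1 - η) p)⁻¹ := by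
    refine sum_le_prod_one_sub_inv (rpowNeg_nonneg _) (rpowNeg_prime_lt_one (by linarith))
      (primes_of_primesLE y) fun m hm => ?_
    obtain ⟨hm1, hms, -⟩ := mem_filter.1 hm
    have := (mem_Icc.1 hm1).1
    exact ⟨by omega, fun p hp hpm => Nat.mem_primesLE.2 ⟨hms p hp hpm, hp⟩⟩
  have h4 : ∏ p ∈ Nat.primesLE y, (1 - rpowNeg (1 - η) p)⁻¹ ≤ (1300 * Real.log y) ^ 11 := by
    calc ∏ p ∈ Nat.primesLE y, (1 - rpowNeg (1 - η) p)⁻¹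
        ≤ ∏ p ∈ Nat.primesLE y, ((1 - 1 / (p : ℝ))⁻¹) ^ 11 := by
          refine prod_le_prod (fun p hp => ?_) fun p hp => ?_
          · have := rpowNeg_prime_lt_one (show 0 < 1 - η by linarith)
              (Nat.prime_of_mem_primesLE hp)
            exact inv_nonneg.2 (by linarith)
          · have hpp := Nat.prime_of_mem_primesLE hp
            have hp2 : (2 : ℝ) ≤ p := by exact_mod_cast hpp.two_le
            have hp0 : (0 : ℝ) < p := by linarith
            set t : ℝ := 1 / (p : ℝ) with ht
            have ht0 : 0 < t := by positivity
            have ht2 : t ≤ 1 / 2 := one_div_le_one_div_of_le two_pos hp2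
            set s := rpowNeg (1 - η) p with hs
            have hs0 : 0 ≤ s := rpowNeg_nonneg _ _
            have hs34 : s ≤ 3 / 4 := by
              have h5 : s ≤ (p : ℝ) ^ (-(1 / 2 : ℝ)) := by
                rw [hs, rpowNeg_apply]
                exact Real.rpow_le_rpow_of_exponent_le (by linarith) (by linarith)
              have h6 : (p : ℝ) ^ (-(1 / 2 : ℝ)) ≤ (2 : ℝ) ^ (-(1 / 2 : ℝ)) :=
                Real.rpow_le_rpow_of_nonpos two_pos hp2 (by norm_num)
              have h7 : (2 : ℝ) ^ (-(1 / 2 : ℝ)) ≤ 3 / 4 := by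
                rw [Real.rpow_neg two_pos.le, ← Real.sqrt_eq_rpow, inv_le_comm₀ (by positivity)
                  (by norm_num)]
                exact Real.le_sqrt_of_sq_le (by norm_num)
              linarith
            have hst : s ≤ t * Real.exp 1 := by
              rw [hs, rpowNeg_apply, show -(1 - η) = -1 + η by ring, Real.rpow_add hp0,
                Real.rpow_neg_one, ← one_div, Real.rpow_def_of_pos hp0]
              refine mul_le_mul_of_nonneg_left (Real.exp_le_exp.2 ?_) ht0.le
              rw [hη, mul_one_div, div_le_one (by linarith)]
              exact Real.log_le_log hp0 (by exact_mod_cast Nat.le_of_mem_primesLE hp)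
            have h5 : (1 - s)⁻¹ ≤ Real.exp (4 * s) := by
              rw [inv_le_iff_one_le_mul₀ (by linarith)]
              have := Real.add_one_le_exp (4 * s)
              nlinarith
            have h6 : 4 * s ≤ 11 * t := by
              have := Real.exp_one_lt_d9
              nlinarith
            have h7 : Real.exp t ≤ (1 - t)⁻¹ := by
              rw [← one_div, le_div_iff₀ (by linarith)]
              have := Real.add_one_le_exp (-t)
              rw [Real.exp_neg] at this
              have he := Real.exp_pos t
              calc Real.exp t * (1 - t) ≤ Real.exp t * (Real.exp t)⁻¹ := by gcongr; linarith
                _ = 1 := mul_inv_cancel₀ he.ne'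
            calc (1 - s)⁻¹ ≤ Real.exp (4 * s) := h5
              _ ≤ Real.exp ((11 : ℕ) * t) := Real.exp_le_exp.2 (by push_cast; exact h6)
              _ = Real.exp t ^ 11 := Real.exp_nat_mul _ _
              _ ≤ ((1 - t)⁻¹) ^ 11 := pow_le_pow_left₀ (Real.exp_pos t).le h7 11
      _ = eulerProd (Nat.primesLE y) ^ 11 := by rw [eulerProd, prod_pow]
      _ ≤ (1300 * Real.log y) ^ 11 :=
          pow_le_pow_left₀ (eulerProd_pos (primes_of_primesLE y)).le
            (eulerProd_primesLE_le (by omega)) 11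
  have h5 : recipSum S ≤
      (1300 * Real.log y) ^ 11 * Real.exp (-(Real.log W / Real.log y)) := by
    rw [mul_comm]
    exact h2.trans (mul_le_mul_of_nonneg_left (h3.trans h4) (Real.exp_pos _).le)
  exact h1.trans (mul_le_mul h5 (recipSum_Icc_le N) (recipSum_nonneg _) (by positivity))

/-- The prime powers dividing `n` have von Mangoldt weights summing to `log n`. -/
lemma card_primePow_dvd_le {P : Finset ℕ} (hP : ∀ q ∈ P, IsPrimePow q) {n : ℕ} (hn : n ≠ 0) :
    (#{q ∈ P | q ∣ n} : ℝ) ≤ 2 * Real.log n := by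
  have hlog2 := Real.log_two_gt_d9
  have h1 : ∀ q ∈ {q ∈ P | q ∣ n}, Real.log 2 ≤ ArithmeticFunction.vonMangoldt q := fun q hq => by
    have hq' := hP q (mem_filter.1 hq).1
    rw [ArithmeticFunction.vonMangoldt_apply, if_pos hq']
    exact Real.log_le_log two_pos (by exact_mod_cast (Nat.minFac_prime hq'.ne_one).two_le)
  have h2 := sum_le_sum h1
  rw [sum_const, nsmul_eq_mul] at h2
  have h3 : ∑ q ∈ {q ∈ P | q ∣ n}, ArithmeticFunction.vonMangoldt q ≤ Real.log n := by
    rw [← ArithmeticFunction.vonMangoldt_sum]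
    exact sum_le_sum_of_subset_of_nonneg
      (fun q hq => Nat.mem_divisors.2 ⟨(mem_filter.1 hq).2, hn⟩)
      fun _ _ _ => ArithmeticFunction.vonMangoldt_nonneg
  have h4 : (0 : ℝ) ≤ #{q ∈ P | q ∣ n} := Nat.cast_nonneg _
  nlinarith

/-! ### Selecting a well-structured subset -/

/-- A subset of nearly full reciprocal sum in which the multiples of every occurring prime power `q`
carry at least `ρ / q`. -/
lemma exists_subset_multiplesIn_large {A : Finset ℕ} (hA : ∀ n ∈ A, n ≠ 0) {ρ : ℝ}
    (hρ : 0 ≤ ρ) :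
    ∃ A' ⊆ A, recipSum A - ρ * recipSum (primePowDivisors A) ≤ recipSum A' ∧
      ∀ q ∈ primePowDivisors A', ρ / (q : ℝ) ≤ recipSum (multiplesIn A' q) := by
  -- A maximiser of this functional cannot gain from discarding all multiples of a prime power.
  obtain ⟨A', hA', hmax⟩ := exists_max_image A.powerset
    (fun B => recipSum B - ρ * recipSum (primePowDivisors B)) ⟨A, mem_powerset_self A⟩
  have hA'A := mem_powerset.1 hA'
  refine ⟨A', hA'A, ?_, fun q hq => ?_⟩
  · have h1 := hmax A (mem_powerset_self A)
    have h2 := mul_nonneg hρ (recipSum_nonneg (primePowDivisors A'))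
    linarith
  · by_contra! hlt
    have h1 := hmax (A' \ multiplesIn A' q) (mem_powerset.2 (sdiff_subset.trans hA'A))
    have h2 : recipSum (A' \ multiplesIn A' q) + recipSum (multiplesIn A' q) = recipSum A' :=
      sum_sdiff (filter_subset _ _)
    have h3 : primePowDivisors (A' \ multiplesIn A' q) ⊆ (primePowDivisors A').erase q := by
      intro r hr
      obtain ⟨hrp, n, hn, hrn⟩ := (mem_primePowDivisors fun n hn =>
        hA n (hA'A (sdiff_subset hn))).1 hr
      obtain ⟨hn1, hn2⟩ := mem_sdiff.1 hn
      refine mem_erase.2 ⟨?_, (mem_primePowDivisors fun n hn => hA n (hA'A hn)).2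
        ⟨hrp, n, hn1, hrn⟩⟩
      rintro rfl
      exact hn2 (mem_multiplesIn.2 ⟨hn1, hrn⟩)
    have h4 := recipSum_mono h3
    have h5 : recipSum ((primePowDivisors A').erase q) + 1 / (q : ℝ) =
        recipSum (primePowDivisors A') := sum_erase_add _ _ hq
    have h6 : ρ * recipSum (primePowDivisors (A' \ multiplesIn A' q)) ≤
        ρ * (recipSum (primePowDivisors A') - 1 / q) :=
      mul_le_mul_of_nonneg_left (by linarith) hρ
    have h7 : ρ * (recipSum (primePowDivisors A') - 1 / q) =
      ρ * recipSum (primePowDivisors A') - ρ / q := by ring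
    linarith

/-- Pigeonhole over the windows `[exp (j * w), exp ((j + 1) * w)]`. -/
lemma exists_window {A : Finset ℕ} {N : ℕ} (hA : ∀ n ∈ A, n ≠ 0 ∧ n ≤ N) {w : ℝ} (hw : 0 < w) :
    ∃ j : ℕ, recipSum A ≤ (Real.log N / w + 1) *
      recipSum {n ∈ A | Real.exp (j * w) ≤ n ∧ (n : ℝ) ≤ Real.exp ((j + 1) * w)} := by
  set J := ⌊Real.log N / w⌋₊ + 1 with hJ
  have hmaps : ∀ n ∈ A, ⌊Real.log n / w⌋₊ ∈ range J := fun n hn => by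
    rw [mem_range, hJ, Nat.lt_succ_iff]
    refine Nat.floor_le_floor ?_
    have := Nat.pos_of_ne_zero (hA n hn).1
    gcongr
    exact (hA n hn).2
  have hsum := sum_fiberwise_of_maps_to hmaps fun n => 1 / (n : ℝ)
  obtain ⟨j, -, hj⟩ : ∃ j ∈ range J, recipSum A / J ≤
      ∑ n ∈ A with ⌊Real.log (n : ℕ) / w⌋₊ = j, 1 / (n : ℝ) := by
    apply exists_le_of_sum_le (by simp [hJ])
    rw [hsum, sum_const, card_range, nsmul_eq_mul]
    have : (0 : ℝ) < J := by rw [hJ]; positivity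
    exact (mul_div_cancel₀ _ this.ne').le
  refine ⟨j, ?_⟩
  have hJ0 : (0 : ℝ) < J := by rw [hJ]; positivity
  have hJle : (J : ℝ) ≤ Real.log N / w + 1 := by
    rw [hJ]
    push_cast
    have := Nat.floor_le (show 0 ≤ Real.log N / w from
      div_nonneg (Real.log_natCast_nonneg N) hw.le)
    linarith
  rw [div_le_iff₀ hJ0] at hj
  have hsub : recipSum {n ∈ A | ⌊Real.log (n : ℕ) / w⌋₊ = j} ≤
      recipSum {n ∈ A | Real.exp (j * w) ≤ n ∧ (n : ℝ) ≤ Real.exp ((j + 1) * w)} := by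
    refine recipSum_mono fun n hn => ?_
    obtain ⟨hnA, hnj⟩ := mem_filter.1 hn
    have hn0 : (0 : ℝ) < n := by exact_mod_cast Nat.pos_of_ne_zero (hA n hnA).1
    have hnn : 0 ≤ Real.log n / w := div_nonneg (Real.log_natCast_nonneg n) hw.le
    obtain ⟨h1, h2⟩ := (Nat.floor_eq_iff hnn).1 hnj
    rw [le_div_iff₀ hw] at h1
    rw [div_lt_iff₀ hw] at h2
    exact mem_filter.2 ⟨hnA, (Real.le_log_iff_exp_le hn0).1 h1,
      (Real.log_le_iff_le_exp hn0).1 h2.le⟩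
  calc recipSum A ≤ recipSum {n ∈ A | ⌊Real.log (n : ℕ) / w⌋₊ = j} * J := hj
    _ ≤ recipSum {n ∈ A | Real.exp (j * w) ≤ n ∧ (n : ℝ) ≤ Real.exp ((j + 1) * w)} *
        (Real.log N / w + 1) := mul_le_mul hsub hJle hJ0.le (recipSum_nonneg _)
    _ = _ := mul_comm _ _

/-! ### Sets in a short logarithmic window -/

lemma card_primePowDivisors_le {A : Finset ℕ} {Y : ℝ}
    (hY : ∀ q ∈ primePowDivisors A, (q : ℝ) ≤ Y) (hY0 : 0 ≤ Y) :
    (#(primePowDivisors A) : ℝ) ≤ Y := by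
  have h1 : primePowDivisors A ⊆ Icc 1 ⌊Y⌋₊ := fun q hq =>
    mem_Icc.2 ⟨pos_of_mem_primePowDivisors hq, Nat.le_floor (hY q hq)⟩
  have h2 := card_le_card h1
  rw [Nat.card_Icc, Nat.add_sub_cancel] at h2
  exact (Nat.cast_le.2 h2).trans (Nat.floor_le hY0)

lemma one_add_pow_sub_one_le {z Y : ℝ} {k : ℕ} (hz : 0 ≤ z) (hk : (k : ℝ) ≤ Y) (hYz : Y * z ≤ 1) :
    (1 + z) ^ k - 1 ≤ 2 * (Y * z) := by
  have hkz : k * z ≤ Y * z := mul_le_mul_of_nonneg_right hk hz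
  have hkz0 : 0 ≤ k * z := by positivity
  have h1 : (1 + z) ^ k ≤ Real.exp (k * z) := by
    rw [Real.exp_nat_mul]
    exact pow_le_pow_left₀ (by linarith) (by linarith [Real.add_one_le_exp z]) k
  have h2 := (abs_le.1 (Real.abs_exp_sub_one_sub_id_le (x := k * z)
    (by rw [abs_of_nonneg hkz0]; linarith))).2
  nlinarith

/-- The circle method for a set inside `[exp μ, exp (μ + w)]`, with intervals of length
`exp (μ - 2 * w)` and prime powers up to `exp (μ - 6 * w)`. -/
lemma exists_recipSum_eq_one_of_window {A : Finset ℕ} {N y r : ℕ} {L w μ ρ : ℝ}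
    (hL : L = Real.log N) (hL1 : 100 ≤ L) (hw : 100 * L ^ 4 ≤ Real.exp w)
    (hA : ∀ n ∈ A, Real.exp μ ≤ n ∧ (n : ℝ) ≤ Real.exp (μ + w))
    (hAN : ∀ n ∈ A, n ≤ N) (hA1 : ∀ n ∈ A, n ≠ 1) (hR : 2 ≤ recipSum A)
    (hpp : ∀ n ∈ A, ∀ q, IsPrimePow q → q ∣ n → q * Real.exp (7 * w) < n)
    (hsm : ∀ n ∈ A, ∀ m, m ∣ n → Smooth y m → (m : ℝ) ≤ Real.exp w) (hρ1 : 1 ≤ ρ)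
    (hρ : ∀ q ∈ primePowDivisors A, ρ / (q : ℝ) ≤ recipSum (multiplesIn A q))
    (hy : 2 ≤ y) (hyN : y ≤ N) (hr : 2 ≤ r) (hrL : Real.exp L < 2 ^ r)
    (hτ : 1300 * Real.log y * (3900 * Real.log r) <
      (ρ / (2 * (1300 * L / Real.log y))) ^ 2) :
    ∃ B ⊆ A, recipSum B = 1 := by
  have hA0 : ∀ n ∈ A, n ≠ 0 := fun n hn => by
    have := (Real.exp_pos μ).trans_le (hA n hn).1
    exact_mod_cast this.ne'
  have hL4 : L ≤ L ^ 4 := le_self_pow₀ (by linarith) (by norm_num)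
  have hL34 : L ^ 3 ≤ L ^ 4 := pow_le_pow_right₀ (by linarith) (by norm_num)
  have hw1 : 1 < Real.exp w := by linarith
  have hw0 : 0 < w := Real.one_lt_exp_iff.1 hw1
  obtain ⟨n₀, hn₀⟩ : A.Nonempty := by
    rw [nonempty_iff_ne_empty]
    rintro rfl
    simp [recipSum] at hR
    linarith
  have hμ6 : 6 * w ≤ μ := by
    have h1 := Nat.minFac_prime (hA1 n₀ hn₀)
    have h2 := hpp n₀ hn₀ _ h1.prime.isPrimePow (Nat.minFac_dvd n₀)
    have h3 : (1 : ℝ) ≤ n₀.minFac := by exact_mod_cast h1.one_lt.le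
    have h4 : Real.exp (7 * w) ≤ n₀.minFac * Real.exp (7 * w) :=
      le_mul_of_one_le_left (Real.exp_pos _).le h3
    have h5 := Real.exp_lt_exp.1 ((h4.trans_lt h2).trans_le (hA n₀ hn₀).2)
    linarith
  have hμL : μ ≤ L := by
    rw [hL, Real.le_log_iff_exp_le]
    · exact (hA n₀ hn₀).1.trans (by exact_mod_cast hAN n₀ hn₀)
    · have h1 := hAN n₀ hn₀
      have h2 := hA0 n₀ hn₀
      exact_mod_cast (by omega : 0 < N)
  have hY : ∀ q ∈ primePowDivisors A, (q : ℝ) ≤ Real.exp (μ - 6 * w) := by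
    intro q hq
    obtain ⟨hqp, n, hn, hqn⟩ := (mem_primePowDivisors hA0).1 hq
    have h1 := (hpp n hn q hqp hqn).le.trans (hA n hn).2
    rw [← le_div_iff₀ (Real.exp_pos _), ← Real.exp_sub] at h1
    exact h1.trans (Real.exp_le_exp.2 (by linarith))
  have hRL : recipSum A ≤ 2 * L := by
    have h1 : A ⊆ Icc 1 N := fun n hn =>
      mem_Icc.2 ⟨Nat.pos_of_ne_zero (hA0 n hn), hAN n hn⟩
    have := (recipSum_mono h1).trans (recipSum_Icc_le N)
    rw [← hL] at this
    linarith
  have hlogy : 0 < Real.log y := Real.log_pos (by exact_mod_cast hy)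
  have hexpw : ∀ c : ℝ, 1 ≤ c → 100 * L ^ 4 ≤ Real.exp (c * w) := fun c hc =>
    hw.trans (Real.exp_le_exp.2 (le_mul_of_one_le_left hw0.le hc))
  refine exists_recipSum_eq_one_of_structure (M := Real.exp μ) (V := Real.exp (μ + w))
    (K := Real.exp (μ - 2 * w)) (Y := Real.exp (μ - 6 * w))
    (H := Real.exp ((μ + w) / 2) * L) (w := 2 * L) (b := Real.exp w / (8 * L ^ 2))
    (Real.exp_pos μ) (fun n hn => (hA n hn).1) (fun n hn => (hA n hn).2) hR hY (Real.exp_pos _)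
    (Real.one_le_exp (by linarith)) ?_ ?_ ?_ (by linarith) ?_ (by positivity) ?_ ?_ ?_ ?_ ?_ ?_
  · have h1 := hexpw 2 (by norm_num)
    have h2 : Real.exp μ = Real.exp (μ - 2 * w) * Real.exp (2 * w) := by
      rw [← Real.exp_add]; congr 1; ring
    rw [h2, mul_comm]
    refine mul_le_mul_of_nonneg_left ?_ (Real.exp_pos _).le
    linarith
  · refine exists_common_multiple_of_rich (N := N) (y := y) (W := Real.exp w) (ρ := ρ)
      (U := 1300 * L / Real.log y) (Real.exp_pos μ) (fun n hn => (hA n hn).1) hAN hsm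
      (Real.exp_pos _).le ?_ (by linarith) hρ (by positivity) ?_ ?_
    · rw [← Real.exp_add]
      exact Real.exp_lt_exp.2 (by linarith)
    · intro T hT
      rw [hL]
      exact recipSum_rough_le hy hyN hT
    · intro P₁ P₂ h₁ h₂ hτ₁ hτ₂
      refine lt_prod_inter hy hr (by positivity) hτ ?_ h₁ h₂ hτ₁ hτ₂
      exact (Real.exp_le_exp.2 (by linarith)).trans_lt hrL
  · intro q hq
    refine le_trans ?_ (hρ q hq)
    gcongr
  · intro n hn
    refine (card_primePow_dvd_le (fun q hq => isPrimePow_of_mem hq) (hA0 n hn)).trans ?_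
    have h1 : Real.log n ≤ Real.log N := Real.log_le_log
      (by exact_mod_cast Nat.pos_of_ne_zero (hA0 n hn)) (by exact_mod_cast hAN n hn)
    linarith
  · have h1 : Real.exp μ = Real.exp ((μ + w) / 2) * Real.exp ((μ - w) / 2) := by
      rw [← Real.exp_add]; congr 1; ring
    have h2 : Real.exp w ≤ Real.exp ((μ - w) / 2) := Real.exp_le_exp.2 (by linarith)
    have h3 : 7 * L ≤ Real.exp ((μ - w) / 2) := by linarith
    rw [h1]
    have := mul_le_mul_of_nonneg_left h3 (Real.exp_pos ((μ + w) / 2)).le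
    linarith
  · have h1 : Real.exp μ ^ 2 = Real.exp ((μ + w) / 2) ^ 3 * Real.exp ((μ - 3 * w) / 2) := by
      rw [← Real.exp_nat_mul, ← Real.exp_nat_mul, ← Real.exp_add]
      congr 1
      push_cast
      ring
    have h2 : Real.exp w ≤ Real.exp ((μ - 3 * w) / 2) := Real.exp_le_exp.2 (by linarith)
    have h3 : 84 * L ^ 3 ≤ Real.exp ((μ - 3 * w) / 2) := by
      have : 0 ≤ L ^ 3 := by positivity
      linarith
    rw [h1, mul_pow]
    have := mul_le_mul_of_nonneg_left h3 (show 0 ≤ Real.exp ((μ + w) / 2) ^ 3 by positivity)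
    linarith
  · have h1 : -4 * (Real.exp ((μ + w) / 2) * L) ^ 2 / Real.exp (μ + w) = -4 * L ^ 2 := by
      have : Real.exp ((μ + w) / 2) ^ 2 = Real.exp (μ + w) := by
        rw [← Real.exp_nat_mul]
        congr 1
        push_cast
        ring
      rw [mul_pow, this]
      field_simp
    rw [h1, mul_assoc, ← Real.exp_add]
    have h2 : Real.exp (μ - 2 * w + -4 * L ^ 2) ≤ Real.exp (-100) :=
      Real.exp_le_exp.2 (by nlinarith)
    have h3 : Real.exp (-100) ≤ 1 / 101 := by
      rw [Real.exp_neg, ← one_div]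
      exact one_div_le_one_div_of_le (by norm_num)
        (by linarith [Real.add_one_le_exp (100 : ℝ)])
    linarith
  · have h1 : Real.exp (μ - 2 * w) ^ 2 =
        Real.exp w * (Real.exp (μ + w) * Real.exp (μ - 6 * w)) := by
      rw [← Real.exp_nat_mul, ← Real.exp_add, ← Real.exp_add]
      congr 1
      push_cast
      ring
    rw [h1]
    calc Real.exp w / (8 * L ^ 2) *
          (2 * Real.exp (μ + w) * (2 * L) * Real.exp (μ - 6 * w) * recipSum A)
        ≤ Real.exp w / (8 * L ^ 2) *
          (2 * Real.exp (μ + w) * (2 * L) * Real.exp (μ - 6 * w) * (2 * L)) := by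
          gcongr
      _ = Real.exp w * (Real.exp (μ + w) * Real.exp (μ - 6 * w)) := by
          have : L ≠ 0 := by linarith
          field_simp
          norm_num
  · set K := Real.exp (μ - 2 * w) with hK
    set Y := Real.exp (μ - 6 * w) with hYdef
    set b := Real.exp w / (8 * L ^ 2) with hb
    have hb5 : 3 * L + 100 ≤ b := by
      rw [hb, le_div_iff₀ (by positivity)]
      have h1 : 0 ≤ L ^ 2 := by positivity
      nlinarith
    have hKL : K ≤ Real.exp L := Real.exp_le_exp.2 (by linarith)
    have hYL : Y ≤ Real.exp L := Real.exp_le_exp.2 (by linarith)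
    have hYz : K * (Y * (Y * Real.exp (-b))) ≤ Real.exp (-100) := by
      calc K * (Y * (Y * Real.exp (-b)))
          ≤ Real.exp L * (Real.exp L * (Real.exp L * Real.exp (-b))) := by gcongr
        _ = Real.exp (3 * L - b) := by
            rw [← Real.exp_add, ← Real.exp_add, ← Real.exp_add]
            congr 1
            ring
        _ ≤ Real.exp (-100) := Real.exp_le_exp.2 (by linarith)
    have h3 : Real.exp (-100) ≤ 1 / 101 := by
      rw [Real.exp_neg, ← one_div]
      exact one_div_le_one_div_of_le (by norm_num)
        (by linarith [Real.add_one_le_exp (100 : ℝ)])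
    have hK1 : 1 ≤ K := Real.one_le_exp (by linarith)
    have hYz0 : 0 ≤ Y * (Y * Real.exp (-b)) := by positivity
    have hYz1 : Y * (Y * Real.exp (-b)) ≤ 1 := by nlinarith
    have h4 := one_add_pow_sub_one_le (by positivity)
      (card_primePowDivisors_le hY (Real.exp_pos _).le) hYz1
    have h5 : 6 * K * ((1 + Y * Real.exp (-b)) ^ #(primePowDivisors A) - 1) ≤
        6 * K * (2 * (Y * (Y * Real.exp (-b)))) := mul_le_mul_of_nonneg_left h4 (by positivity)
    linarith
  · have hcard := card_primePowDivisors_le hY (Real.exp_pos _).le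
    have h1 := lcm_le_lcm_mul_pow (empty_subset (primePowDivisors A))
      (fun q hq => pos_of_mem_primePowDivisors hq) hY
    rw [Finset.lcm_empty, sdiff_empty, Nat.cast_one, div_one, ← Real.exp_nat_mul] at h1
    have hM16 : 100 * L ^ 4 ≤ Real.exp μ := hw.trans (Real.exp_le_exp.2 (by linarith))
    have h2 : #(primePowDivisors A) * (μ - 6 * w) ≤ Real.exp μ / 100 := by
      calc #(primePowDivisors A) * (μ - 6 * w) ≤ Real.exp (μ - 6 * w) * L := by
            gcongr
            linarith
        _ ≤ Real.exp (μ - 6 * w) * (Real.exp (6 * w) / 100) := by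
            gcongr
            have := hexpw 6 (by norm_num)
            linarith
        _ = Real.exp μ / 100 := by
            rw [← mul_div_assoc, ← Real.exp_add]
            congr 2
            ring
    calc _ ≤ Real.exp (Real.exp μ / 100) * (2 * Real.exp (-Real.exp μ / 4)) := by
          gcongr
          exact h1.trans (Real.exp_le_exp.2 h2)
      _ = 2 * Real.exp (-(24 / 100 * Real.exp μ)) := by
          rw [mul_left_comm, ← Real.exp_add]
          congr 2
          ring
      _ ≤ 2 * (1 / 4) := by
          gcongr
          rw [Real.exp_neg, ← one_div]
          refine one_div_le_one_div_of_le (by norm_num) ?_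
          have := Real.add_one_le_exp (24 / 100 * Real.exp μ)
          linarith
      _ = 1 / 2 := by norm_num

/-! ### The theorem for large reciprocal sums -/

open Filter

lemma recipSum_divisible_by_large_le {N : ℕ} (hN : 2 ≤ N) {w : ℝ} (hw : 0 ≤ w) {T : Finset ℕ}
    (hT : ∀ n ∈ T, n ≠ 0 ∧ n ≤ N ∧
      ∃ q : ℕ, IsPrimePow q ∧ q ∣ n ∧ (n : ℝ) ≤ q * Real.exp w) :
    recipSum T ≤ 2 * Real.log (1300 * Real.log N) * (1 + w) := by
  classical
  set S := {q ∈ Icc 1 N | IsPrimePow q} with hS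
  have h1 : recipSum T ≤ recipSum S * recipSum (Icc 1 ⌊Real.exp w⌋₊) := by
    refine recipSum_le_mul fun n hn => ?_
    obtain ⟨hn0, hnN, q, hq, ⟨k, rfl⟩, hle⟩ := hT n hn
    have hk0 : 0 < k := Nat.pos_of_ne_zero (right_ne_zero_of_mul hn0)
    have hqR : (0 : ℝ) < q := by exact_mod_cast hq.pos
    refine ⟨q, mem_filter.2 ⟨mem_Icc.2 ⟨hq.pos, (Nat.le_mul_of_pos_right q hk0).trans hnN⟩, hq⟩,
      k, mem_Icc.2 ⟨hk0, Nat.le_floor ?_⟩, rfl⟩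
    push_cast at hle
    exact le_of_mul_le_mul_left hle hqR
  have h2 : recipSum S ≤ 2 * Real.log (1300 * Real.log N) :=
    recipSum_primePow_le hN fun q hq =>
      ⟨(mem_filter.1 hq).2, (mem_Icc.1 (mem_filter.1 hq).1).2⟩
  have h3 : recipSum (Icc 1 ⌊Real.exp w⌋₊) ≤ 1 + w := by
    refine (recipSum_Icc_le _).trans ?_
    have h4 : (0 : ℝ) < ⌊Real.exp w⌋₊ := by
      exact_mod_cast Nat.floor_pos.2 (Real.one_le_exp hw)
    have h5 := Real.log_le_log h4 (Nat.floor_le (Real.exp_pos w).le)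
    rw [Real.log_exp] at h5
    linarith
  exact h1.trans (mul_le_mul h2 h3 (recipSum_nonneg _) ((recipSum_nonneg S).trans h2))

/-- Discarding the elements with a large prime power or with a large smooth divisor costs little. -/
lemma exists_subset_smooth_parts_small {A : Finset ℕ} {N y : ℕ} {w : ℝ} (hN : 2 ≤ N) (hw : 0 ≤ w)
    (hy : 8 ≤ y) (hA : ∀ n ∈ A, n ≠ 0 ∧ n ≤ N) :
    ∃ A' ⊆ A, (∀ n ∈ A', ∀ q : ℕ, IsPrimePow q → q ∣ n → q * Real.exp (7 * w) < n) ∧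
      (∀ n ∈ A', ∀ m : ℕ, m ∣ n → Smooth y m → (m : ℝ) ≤ Real.exp w) ∧
      recipSum A ≤ recipSum A' + (2 * Real.log (1300 * Real.log N) * (1 + 7 * w) +
        (1300 * Real.log y) ^ 11 * Real.exp (-(w / Real.log y)) * (1 + Real.log N)) := by
  classical
  set A' : Finset ℕ := {n ∈ A |
    (∀ q : ℕ, IsPrimePow q → q ∣ n → q * Real.exp (7 * w) < n) ∧
    ∀ m : ℕ, m ∣ n → Smooth y m → (m : ℝ) ≤ Real.exp w} with hA'
  refine ⟨A', filter_subset _ _, fun n hn => (mem_filter.1 hn).2.1,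
    fun n hn => (mem_filter.1 hn).2.2, ?_⟩
  have h1 := recipSum_divisible_by_large_le hN (show 0 ≤ 7 * w by positivity)
    (T := {n ∈ A | ∃ q : ℕ, IsPrimePow q ∧ q ∣ n ∧ (n : ℝ) ≤ q * Real.exp (7 * w)}) fun n hn => by
      obtain ⟨hnA, hq⟩ := mem_filter.1 hn
      exact ⟨(hA n hnA).1, (hA n hnA).2, hq⟩
  have h2 := recipSum_large_smooth_le (N := N) (Real.exp_pos w) hy
    (T := {n ∈ A | ∃ m : ℕ, m ∣ n ∧ Smooth y m ∧ Real.exp w < (m : ℝ)}) fun n hn => by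
      obtain ⟨hnA, hm⟩ := mem_filter.1 hn
      exact ⟨(hA n hnA).1, (hA n hnA).2, hm⟩
  rw [Real.log_exp] at h2
  refine le_trans ?_ (add_le_add_right (add_le_add h1 h2) (recipSum A'))
  simp only [recipSum, hA', sum_filter, ← sum_add_distrib]
  refine sum_le_sum fun n hn => ?_
  have hpos : 0 ≤ 1 / (n : ℝ) := by positivity
  by_cases h1 : ∃ q : ℕ, IsPrimePow q ∧ q ∣ n ∧ (n : ℝ) ≤ q * Real.exp (7 * w)
  · rw [if_pos h1]
    split_ifs <;> linarith
  · by_cases h2 : ∃ m : ℕ, m ∣ n ∧ Smooth y m ∧ Real.exp w < (m : ℝ)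
    · rw [if_pos h2]
      split_ifs <;> linarith
    · push Not at h1 h2
      rw [if_pos ⟨h1, h2⟩]
      split_ifs <;> linarith

/-- The condition on Euler products in `exists_recipSum_eq_one_of_window`, for `L = u ^ 5`,
`w = u ^ 4` and `log y` about `u ^ 4 / g`. The powers of `u` cancel exactly, which is where the
exponent `4 / 5` comes from, and `g` absorbs the logarithms `l`. Here `Λ` stands for `log y` and `R`
for `log r`. -/
lemma mul_log_lt_sq {L u g l v Λ R : ℝ} (hL : L = u ^ 5) (hu : 1 ≤ u) (hv : u ^ 4 = v * g)
    (hl : 1 ≤ l) (hg : 10 ^ 17 * l ^ 3 ≤ g) (hΛ : v / 2 ≤ Λ) (hΛ0 : 0 < Λ) (hR : R ≤ l) :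
    1300 * Λ * (3900 * R) < (u ^ 3 * g / (16 * l) / (2 * (1300 * L / Λ))) ^ 2 := by
  have hl3 : 1 ≤ l ^ 3 := one_le_pow₀ hl
  have hg0 : 0 < g := by linarith
  have hL0 : 0 < L := by rw [hL]; positivity
  set ρ := u ^ 3 * g / (16 * l) with hρ
  have h1 : ρ / (2 * (1300 * L / Λ)) = ρ * Λ / (2600 * L) := by
    field_simp
    ring
  have h2 : ρ ^ 2 * v / L ^ 2 = g / (256 * l ^ 2) := by
    have h3 : v = u ^ 4 / g := by rw [hv]; field_simp
    rw [h3, hρ, hL]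
    field_simp
    norm_num
  have h4 : 1300 * (3900 * l) < g / (256 * l ^ 2) / (2 * 2600 ^ 2) := by
    rw [div_div, lt_div_iff₀ (by positivity)]
    have h5 : 1300 * (3900 * l) * (256 * l ^ 2 * (2 * 2600 ^ 2)) =
      1300 * 3900 * 256 * 2 * 2600 ^ 2 * l ^ 3 := by ring
    rw [h5]
    linarith
  rw [h1]
  calc 1300 * Λ * (3900 * R) = Λ * (1300 * (3900 * R)) := by ring
    _ ≤ Λ * (1300 * (3900 * l)) := by gcongr
    _ < Λ * (g / (256 * l ^ 2) / (2 * 2600 ^ 2)) := mul_lt_mul_of_pos_left h4 hΛ0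
    _ = Λ * (v / 2) * (ρ ^ 2 / (2600 * L) ^ 2) := by
        rw [← h2]
        field_simp
    _ ≤ Λ * Λ * (ρ ^ 2 / (2600 * L) ^ 2) := by gcongr
    _ = (ρ * Λ / (2600 * L)) ^ 2 := by
        rw [div_pow]
        ring

/-- Some window of logarithmic length `u ^ 4` contains a subset with large reciprocal sum in which
every prime power carries its share. -/
lemma exists_balanced_window {A : Finset ℕ} {N : ℕ} {L u g : ℝ} (hA : ∀ n ∈ A, n ≠ 0 ∧ n ≤ N)
    (hN : 2 ≤ N) (hL : L = Real.log N) (hLu : L = u ^ 5) (hu : 1 ≤ u)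
    (hl : 0 < Real.log (1300 * L)) (hg : 0 ≤ g) (hR : u ^ 4 * g / 2 ≤ recipSum A) :
    ∃ (j : ℕ) (A' : Finset ℕ), A' ⊆ A ∧
      (∀ n ∈ A', Real.exp (j * u ^ 4) ≤ n ∧ (n : ℝ) ≤ Real.exp (j * u ^ 4 + u ^ 4)) ∧
      u ^ 3 * g / 8 ≤ recipSum A' ∧ ∀ q ∈ primePowDivisors A',
        u ^ 3 * g / (16 * Real.log (1300 * L)) / (q : ℝ) ≤ recipSum (multiplesIn A' q) := by
  have hu0 : 0 < u := by linarith
  obtain ⟨j, hj⟩ := exists_window hA (show 0 < u ^ 4 by positivity)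
  set A₂ : Finset ℕ := {n ∈ A | Real.exp (j * u ^ 4) ≤ n ∧
    (n : ℝ) ≤ Real.exp ((j + 1) * u ^ 4)} with hA₂
  have hA₂A : A₂ ⊆ A := filter_subset _ _
  have hR₂ : u ^ 3 * g / 4 ≤ recipSum A₂ := by
    rw [← hL] at hj
    have h1 : L / u ^ 4 + 1 ≤ 2 * u := by
      have : L / u ^ 4 = u := by rw [hLu]; field_simp
      rw [this]
      linarith
    have h2 : u ^ 4 * g / 2 ≤ 2 * u * recipSum A₂ :=
      hR.trans (hj.trans (mul_le_mul_of_nonneg_right h1 (recipSum_nonneg _)))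
    have h3 : u ^ 4 * g / 2 = 2 * u * (u ^ 3 * g / 4) := by ring
    rw [h3] at h2
    exact le_of_mul_le_mul_left h2 (by positivity)
  set l := Real.log (1300 * L) with hldef
  set ρ := u ^ 3 * g / (16 * l) with hρ
  have hρ0 : 0 ≤ ρ := by positivity
  obtain ⟨A₃, hA₃A₂, hR₃, hA₃ρ⟩ := exists_subset_multiplesIn_large (A := A₂)
    (fun n hn => (hA n (hA₂A hn)).1) hρ0
  have hP : recipSum (primePowDivisors A₂) ≤ 2 * l := by
    have := recipSum_primePow_le hN (T := primePowDivisors A₂) fun q hq => by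
      refine ⟨isPrimePow_of_mem hq, ?_⟩
      obtain ⟨-, n, hn, hqn⟩ := (mem_primePowDivisors fun n hn => (hA n (hA₂A hn)).1).1 hq
      have h1 := hA n (hA₂A hn)
      exact (Nat.le_of_dvd (Nat.pos_of_ne_zero h1.1) hqn).trans h1.2
    rwa [← hL] at this
  refine ⟨j, A₃, hA₃A₂.trans hA₂A, fun n hn => ?_, ?_, hA₃ρ⟩
  · have := (mem_filter.1 (hA₃A₂ hn)).2
    rwa [add_one_mul] at this
  · have h1 : ρ * recipSum (primePowDivisors A₂) ≤ u ^ 3 * g / 8 := by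
      calc ρ * recipSum (primePowDivisors A₂) ≤ ρ * (2 * l) := by gcongr
        _ = u ^ 3 * g / 8 := by rw [hρ]; field_simp; ring
    linarith

lemma exists_recipSum_eq_one_of_large {ε L : ℝ} (hε0 : 0 < ε) (hε : ε ≤ 1 / 10) {N : ℕ}
    (hL : L = Real.log N) (hL1 : 1300 ≤ L)
    (hbig : 10 ^ 17 * Real.log (1300 * L) ^ 3 ≤ L ^ ε) {A : Finset ℕ} (hA : A ⊆ Icc 1 N)
    (hR : L ^ ((4 / 5 : ℝ) + ε) ≤ recipSum A) : ∃ B ⊆ A, recipSum B = 1 := by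
  classical
  by_cases h1A : 1 ∈ A
  · exact ⟨{1}, by simpa using h1A, by simp [recipSum]⟩
  have hA' : ∀ n ∈ A, n ≠ 0 ∧ n ≤ N := fun n hn => by
    have := mem_Icc.1 (hA hn)
    exact ⟨by omega, this.2⟩
  have hL0 : 0 < L := by linarith
  have hLge1 : 1 ≤ L := by linarith
  have hN0 : 0 < N := by
    rcases Nat.eq_zero_or_pos N with rfl | h
    · simp at hL
      linarith
    · exact h
  have hNexp : (N : ℝ) = Real.exp L := by
    rw [hL, Real.exp_log (by exact_mod_cast hN0)]
  have hN2 : 8 ≤ N := by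
    have h1 := Real.add_one_le_exp L
    rw [← hNexp] at h1
    have : (8 : ℝ) ≤ N := by linarith
    exact_mod_cast this
  obtain ⟨l, hl⟩ : ∃ l, l = Real.log (1300 * L) := ⟨_, rfl⟩
  have hl1 : 1 ≤ l := by
    rw [hl, Real.le_log_iff_exp_le (by positivity)]
    linarith [Real.exp_one_lt_d9]
  have hl3 : l ≤ l ^ 3 := le_self_pow₀ hl1 (by norm_num)
  -- `w` is the logarithmic length of a window; primes up to `y = exp (L ^ (4 / 5 - ε))` are small.
  obtain ⟨w, hw⟩ : ∃ w, w = L ^ (4 / 5 : ℝ) := ⟨_, rfl⟩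
  obtain ⟨v, hv⟩ : ∃ v, v = L ^ ((4 / 5 : ℝ) - ε) := ⟨_, rfl⟩
  obtain ⟨g, hg⟩ : ∃ g, g = L ^ ε := ⟨_, rfl⟩
  rw [← hl, ← hg] at hbig
  have hg0 : 0 < g := hg ▸ Real.rpow_pos_of_pos hL0 _
  have hv0 : 0 < v := hv ▸ Real.rpow_pos_of_pos hL0 _
  have hw0 : 0 < w := hw ▸ Real.rpow_pos_of_pos hL0 _
  have hwv : w = v * g := by
    rw [hw, hv, hg, ← Real.rpow_add hL0]
    congr 1
    ring
  have hR' : L ^ ((4 / 5 : ℝ) + ε) = w * g := by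
    rw [hw, hg, Real.rpow_add hL0]
  have hgv : g ≤ v := by
    rw [hg, hv]
    exact Real.rpow_le_rpow_of_exponent_le hLge1 (by linarith)
  have hvL : v ≤ L := by
    rw [hv]
    conv_rhs => rw [← Real.rpow_one L]
    exact Real.rpow_le_rpow_of_exponent_le hLge1 (by linarith)
  obtain ⟨u, hu⟩ : ∃ u, u = L ^ (1 / 5 : ℝ) := ⟨_, rfl⟩
  have hu1 : 1 ≤ u := hu ▸ Real.one_le_rpow hLge1 (by norm_num)
  have hwu : w = u ^ 4 := by
    rw [hw, hu, ← Real.rpow_natCast, ← Real.rpow_mul hL0.le]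
    norm_num
  have hLu : L = u ^ 5 := by
    rw [hu, ← Real.rpow_natCast, ← Real.rpow_mul hL0.le]
    norm_num
  have hu3 : 1 ≤ u ^ 3 := one_le_pow₀ hu1
  have hgl : 10 ^ 17 * l ≤ g := by linarith
  have hgw : g ≤ w := by
    rw [hwv]
    exact le_mul_of_one_le_left hg0.le (by linarith)
  have hexpl : Real.exp l = 1300 * L := by
    rw [hl, Real.exp_log (by positivity)]
  obtain ⟨y, hy⟩ : ∃ y, y = ⌊Real.exp v⌋₊ := ⟨_, rfl⟩
  have hy8 : 8 ≤ y := hy ▸ Nat.le_floor (by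
    push_cast
    linarith [Real.add_one_le_exp v])
  have hylog : Real.log y ≤ v := by
    rw [Real.log_le_iff_le_exp (by exact_mod_cast (by omega : 0 < y))]
    rw [hy]
    exact Nat.floor_le (Real.exp_pos v).le
  have hylog2 : v / 2 ≤ Real.log y := by
    have h1 : Real.exp v / 2 ≤ y := by
      have := Nat.lt_floor_add_one (Real.exp v)
      rw [← hy] at this
      linarith [Real.add_one_le_exp v]
    have h2 := Real.log_le_log (by positivity) h1
    rw [Real.log_div (Real.exp_pos v).ne' two_ne_zero, Real.log_exp] at h2
    linarith [Real.log_two_lt_d9]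
  have hyN : y ≤ N := by
    have h1 : (y : ℝ) ≤ N := by
      rw [hNexp, hy]
      exact (Nat.floor_le (Real.exp_pos v).le).trans (Real.exp_le_exp.2 hvL)
    exact_mod_cast h1
  have hylog0 : 0 < Real.log y := by linarith
  obtain ⟨A₁, hA₁A, hA₁q, hA₁m, hsplit⟩ := exists_subset_smooth_parts_small (A := A) (N := N)
    (w := w) (by omega) hw0.le hy8 hA'
  have hrankin : (1300 * Real.log y) ^ 11 * Real.exp (-(w / Real.log y)) * (1 + L) ≤ 1 := by
    have h2 : g ≤ w / Real.log y := by
      rw [le_div_iff₀ hylog0, hwv, mul_comm v g]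
      exact mul_le_mul_of_nonneg_left hylog hg0.le
    calc (1300 * Real.log y) ^ 11 * Real.exp (-(w / Real.log y)) * (1 + L)
        ≤ (1300 * L) ^ 11 * Real.exp (-g) * (1300 * L) := by
          gcongr
          · exact hylog.trans hvL
          · linarith
      _ = Real.exp ((12 : ℕ) * l - g) := by
          rw [Real.exp_sub, Real.exp_nat_mul, hexpl, Real.exp_neg]
          ring
      _ ≤ 1 := Real.exp_le_one_iff.2 (by push_cast; linarith)
  have hR₁ : w * g / 2 ≤ recipSum A₁ := by
    rw [hR'] at hR
    rw [← hL, ← hl] at hsplit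
    have h1 : 2 * l * (1 + 7 * w) + 1 ≤ w * g / 2 := by
      have hw1 : 1 ≤ w := by linarith
      have h2 : 34 * l ≤ g := by linarith only [hgl, hl1]
      have h3 := mul_le_mul_of_nonneg_left h2 hw0.le
      have h4 : l ≤ w * l := le_mul_of_one_le_left (by linarith) hw1
      linarith only [h3, h4, hl1]
    linarith
  obtain ⟨j, A₃, hA₃A₁, hA₃w, hR₃, hA₃ρ⟩ := exists_balanced_window (A := A₁) (N := N)
    (fun n hn => hA' n (hA₁A hn)) (by omega) hL hLu hu1 (by linarith) hg0.le (by
      rw [← hwu]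
      exact hR₁)
  rw [← hl] at hA₃ρ
  rw [← hwu] at hA₃w
  have hug : g ≤ u ^ 3 * g := le_mul_of_one_le_left hg0.le hu3
  have hρ1 : 1 ≤ u ^ 3 * g / (16 * l) := by
    rw [le_div_iff₀ (by positivity)]
    linarith
  -- The choice of `r` makes `2 ^ r` exceed `exp L = N`, hence every interval length in use.
  obtain ⟨r, hr⟩ : ∃ r, r = ⌈2 * L⌉₊ := ⟨_, rfl⟩
  have hr2L : 2 * L ≤ r := hr ▸ Nat.le_ceil _
  have hr3L : (r : ℝ) ≤ 3 * L := by
    have := Nat.ceil_lt_add_one (show 0 ≤ 2 * L by positivity)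
    rw [← hr] at this
    linarith
  have hr2 : 2 ≤ r := by
    have : (2 : ℝ) ≤ r := by linarith
    exact_mod_cast this
  have hrL : Real.exp L < 2 ^ r := by
    have h1 : Real.exp L < Real.exp (Real.log 2 * r) :=
      Real.exp_lt_exp.2 (by
        have h2 : 0.6 * (r : ℝ) ≤ Real.log 2 * r :=
          mul_le_mul_of_nonneg_right (by linarith only [Real.log_two_gt_d9]) (Nat.cast_nonneg r)
        linarith only [h2, hr2L, hL0])
    rwa [Real.exp_mul, Real.exp_log two_pos, Real.rpow_natCast] at h1
  have hwL4 : 100 * L ^ 4 ≤ Real.exp w := by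
    calc 100 * L ^ 4 ≤ (1300 * L) ^ 4 := by
          rw [mul_pow]
          gcongr
          norm_num
      _ = Real.exp ((4 : ℕ) * l) := by rw [Real.exp_nat_mul, hexpl]
      _ ≤ Real.exp w := Real.exp_le_exp.2 (by push_cast; linarith)
  have hτ := mul_log_lt_sq hLu hu1 (by rw [← hwu, hwv]) hl1 hbig hylog2 hylog0
    (show Real.log r ≤ l from hl ▸ Real.log_le_log (by linarith) (by linarith))
  obtain ⟨B, hB, hB1⟩ := exists_recipSum_eq_one_of_window hL (by linarith) hwL4 hA₃w
    (fun n hn => (hA' n (hA₁A (hA₃A₁ hn))).2) (fun n hn h => h1A (h ▸ hA₁A (hA₃A₁ hn)))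
    (by linarith) (fun n hn => hA₁q n (hA₃A₁ hn)) (fun n hn => hA₁m n (hA₃A₁ hn)) hρ1 hA₃ρ
    (by omega) hyN hr2 hrL hτ
  exact ⟨B, hB.trans (hA₃A₁.trans hA₁A), hB1⟩

lemma eventually_log_cube_le {ε : ℝ} (hε : 0 < ε) :
    ∀ᶠ L : ℝ in atTop, 10 ^ 17 * Real.log (1300 * L) ^ 3 ≤ L ^ ε := by
  have h1 := (isLittleO_log_rpow_rpow_atTop (3 : ℝ) hε).bound
    (show (0 : ℝ) < 1 / (8 * 10 ^ 17) by norm_num)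
  filter_upwards [h1, eventually_ge_atTop 1300] with L hL hL1
  have hL0 : 0 < L := by linarith
  have hlog : 0 ≤ Real.log L := Real.log_nonneg (by linarith)
  have h3 : Real.log L ^ (3 : ℝ) = Real.log L ^ 3 := by
    rw [← Real.rpow_natCast]
    norm_num
  rw [h3, Real.norm_of_nonneg (by positivity), Real.norm_of_nonneg (by positivity)] at hL
  have h2 : Real.log (1300 * L) ≤ 2 * Real.log L := by
    rw [Real.log_mul (by norm_num) hL0.ne']
    have := Real.log_le_log (by norm_num) hL1
    linarith
  have h4 : Real.log (1300 * L) ^ 3 ≤ (2 * Real.log L) ^ 3 :=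
    pow_le_pow_left₀ (Real.log_nonneg (by linarith)) h2 3
  calc 10 ^ 17 * Real.log (1300 * L) ^ 3 ≤ 10 ^ 17 * (2 * Real.log L) ^ 3 := by gcongr
    _ = 8 * 10 ^ 17 * Real.log L ^ 3 := by ring
    _ ≤ 8 * 10 ^ 17 * (1 / (8 * 10 ^ 17) * L ^ ε) := by gcongr
    _ = L ^ ε := by ring

lemma tendsto_log_natCast : Tendsto (fun N : ℕ => Real.log N) atTop atTop :=
  Real.tendsto_log_atTop.comp tendsto_natCast_atTop_atTop

theorem eventually_exists_recipSum_eq_one {ε : ℝ} (hε : 0 < ε) :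
    ∀ᶠ N : ℕ in atTop, ∀ A : Finset ℕ, A ⊆ Icc 1 N →
      Real.log N ^ ((4 / 5 : ℝ) + ε) ≤ recipSum A → ∃ B : Finset ℕ, B ⊆ A ∧ recipSum B = 1 := by
  have hδ : 0 < min ε (1 / 10) := by positivity
  filter_upwards [tendsto_log_natCast.eventually (eventually_log_cube_le hδ),
    tendsto_log_natCast.eventually_ge_atTop 1300] with N h1 h2 A hA hR
  refine exists_recipSum_eq_one_of_large hδ (min_le_right _ _) rfl h2 h1 hA (le_trans ?_ hR)
  exact Real.rpow_le_rpow_of_exponent_le (by linarith) (by linarith [min_le_left ε (1 / 10)])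

/-! ### Consequences for `λ(N)` -/

lemma eventually_lam_lt {ε : ℝ} (hε : 0 < ε) :
    ∀ᶠ N : ℕ in atTop, lam N < Real.log N ^ ((4 / 5 : ℝ) + ε) := by
  filter_upwards [eventually_exists_recipSum_eq_one hε] with N hN
  obtain ⟨A, hA, hfree, hAlam⟩ := (lam_isGreatest N).1
  by_contra! hle
  rw [← hAlam] at hle
  obtain ⟨B, hB, hB1⟩ := hN A hA hle
  exact hfree B hB hB1

lemma exists_exponent_tendsto_zero : ∃ o : ℕ → ℝ, Tendsto o atTop (nhds 0) ∧
    ∀ᶠ N : ℕ in atTop, lam N ≤ Real.log N ^ ((4 / 5 : ℝ) + o N) := by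
  classical
  -- Where `lam N` is small (possibly `0`, with a junk logarithm) the exponent `4 / 5` is enough.
  refine ⟨fun N => if lam N ≤ Real.log N ^ (4 / 5 : ℝ) then 0 else
    Real.log (lam N) / Real.log (Real.log N) - 4 / 5, ?_, ?_⟩
  · rw [Metric.tendsto_nhds]
    intro ε hε
    filter_upwards [eventually_lam_lt (half_pos hε), tendsto_log_natCast.eventually_ge_atTop 3]
      with N hN hN3
    rw [Real.dist_eq, sub_zero]
    split_ifs with h
    · simpa using hε
    · have hL0 : 0 < Real.log N := by linarith
      have hll : 0 < Real.log (Real.log N) := Real.log_pos (by linarith)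
      push Not at h
      have hlam : 0 < lam N := lt_trans (by positivity) h
      have h1 := Real.log_lt_log (by positivity) h
      have h2 := Real.log_lt_log hlam hN
      rw [Real.log_rpow hL0] at h1 h2
      rw [← lt_div_iff₀ hll] at h1
      rw [← div_lt_iff₀ hll] at h2
      rw [abs_lt]
      constructor <;> linarith
  · filter_upwards [tendsto_log_natCast.eventually_ge_atTop 3] with N hN3
    have hL0 : 0 < Real.log N := by linarith
    have hll : 0 < Real.log (Real.log N) := Real.log_pos (by linarith)
    split_ifs with h
    · simpa using h
    · push Not at h
      have hlam : 0 < lam N := lt_trans (by positivity) h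
      rw [add_sub_cancel, Real.rpow_def_of_pos hL0, mul_div_cancel₀ _ hll.ne',
        Real.exp_log hlam]

lemma lam_isLittleO : lam =o[atTop] (fun N : ℕ =>
    Real.log N * Real.log (Real.log (Real.log N)) / Real.log (Real.log N)) := by
  have hlog : (fun L : ℝ => Real.log L) =o[atTop] fun L => L ^ (1 / 10 : ℝ) :=
    isLittleO_log_rpow_atTop (by norm_num)
  rw [Asymptotics.isLittleO_iff]
  intro c hc
  filter_upwards [eventually_lam_lt (show (0 : ℝ) < 1 / 10 by norm_num),
    tendsto_log_natCast.eventually (hlog.bound hc),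
    tendsto_log_natCast.eventually_ge_atTop (Real.exp (Real.exp 1))] with N h1 h2 h3
  have hee : 1 < Real.exp (Real.exp 1) := Real.one_lt_exp_iff.2 (Real.exp_pos 1)
  set L := Real.log N with hL
  have hL0 : 0 < L := by linarith
  have hll : Real.exp 1 ≤ Real.log L := (Real.le_log_iff_exp_le hL0).2 h3
  have hll0 : 0 < Real.log L := (Real.exp_pos 1).trans_le hll
  have hlll : 1 ≤ Real.log (Real.log L) := (Real.le_log_iff_exp_le hll0).2 hll
  have hlam : 0 ≤ lam N := by
    obtain ⟨A, -, -, hA⟩ := (lam_isGreatest N).1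
    rw [← hA]
    exact recipSum_nonneg A
  rw [Real.norm_of_nonneg hll0.le, Real.norm_of_nonneg (by positivity)] at h2
  rw [Real.norm_of_nonneg hlam, Real.norm_of_nonneg (by positivity), mul_div_assoc',
    le_div_iff₀ hll0]
  have hsplit : L = L ^ ((4 / 5 : ℝ) + 1 / 10) * L ^ (1 / 10 : ℝ) := by
    rw [← Real.rpow_add hL0]
    norm_num
  calc lam N * Real.log L ≤ L ^ ((4 / 5 : ℝ) + 1 / 10) * (c * L ^ (1 / 10 : ℝ)) := by
        gcongr
    _ = c * L := by
        conv_rhs => rw [hsplit]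
        ring
    _ ≤ c * (L * Real.log (Real.log L)) := by
        gcongr
        exact le_mul_of_one_le_right hL0.le hlll

end UnitFractions

theorem theorem1p1 :
    (∀ ε : ℝ, 0 < ε → ∃ N₀ : ℕ, ∀ N : ℕ, N₀ ≤ N →
      ∀ A : Finset ℕ, A ⊆ Finset.Icc 1 N →
        Real.log N ^ ((4 / 5 : ℝ) + ε) ≤ recipSum A →
        ∃ B : Finset ℕ, B ⊆ A ∧ recipSum B = 1) ∧
    (∃ o : ℕ → ℝ, Filter.Tendsto o Filter.atTop (nhds 0) ∧
      ∀ᶠ N : ℕ in Filter.atTop, lam N ≤ Real.log N ^ ((4 / 5 : ℝ) + o N)) ∧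
    lam =o[Filter.atTop] (fun N : ℕ =>
      Real.log N * Real.log (Real.log (Real.log N)) / Real.log (Real.log N)) :=
  ⟨fun _ hε => Filter.eventually_atTop.1 (UnitFractions.eventually_exists_recipSum_eq_one hε),
    UnitFractions.exists_exponent_tendsto_zero, UnitFractions.lam_isLittleO⟩
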